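/- Let $\mathcal H$ be the Butcher–Connes–Kreimer Hopf algebra over $\mathbb R$: the free commutative algebra on the (non-empty, finite, non-planar) rooted trees, with coproduct $\Delta(\tau)=\sum_c P_c(\tau)\otimes R_c(\tau)$ over the admissible cuts $c$ of $\tau$ (the empty and the total cut included, $P_c(\tau)$ being the pruned forest and $R_c(\tau)$ the remaining tree at the root), and antipode $S$. Let $|\tau|$ be the number of vertices of $\tau$ and $\bar S(\tau)=(-1)^{|\tau|}S(\tau)$. Let $\mathrm{Id}^{1/2}$ be the unique multiplicative linear map $\mathcal H\to\mathcal H$ whose convolution square is the identity map. With $\mu$ the multiplication of $\mathcal H$, put $$\tau^-=\mu\circ(\bar S\otimes\mathrm{Id})\circ\Delta\circ\mathrm{Id}^{1/2}(\tau),\qquad \tau^+=\mu\circ\bigl(\mathrm{Id}\otimes((\cdot)^-\circ S)\bigr)\circ\Delta(\tau).$$ The antisymmetric order of a character (unital algebra homomorphism) $\psi:\mathcal H\to\mathbb R$ is $$\mathrm{ord}^+(\psi)=\sup\{n\in\mathbb N:\ \psi(\tau^+)=0\text{ for all trees }\tau\text{ with }|\tau|\le n\}\in\mathbb N\cup\{\infty\}.$$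 Let $f:\mathbb R^N\to\mathbb R^N$ be a smooth vector field. The B-series method with character $\psi$ is the formal power series in $h$ $$B_h(\psi,y)=y+\sum_{\tau}\frac{h^{|\tau|}}{\sigma(\tau)}\,\psi(\tau)\,F(\tau)(y),$$ where the sum is over all rooted trees, $\sigma(\tau)$ is the symmetry factor of $\tau$ and $F(\tau)$ is the elementary differential, $F([\tau_1,\dots,\tau_k])(y)=f^{(k)}(y)\bigl(F(\tau_1)(y),\dots,F(\tau_k)(y)\bigr)$. Its modified differential equation is the formal equation $\dot{\tilde y}=f_1(\tilde y)+hf_2(\tilde y)+h^2f_3(\tilde y)+\cdots$ with smooth fields $f_j:\mathbb R^N\to\mathbb R^N$ whose formal exact solution at time $h$ with initial value $y$ equals $B_h(\psi,y)$, as a formal power series in $h$, for every $y\in\mathbb R^N$. **Theorem.** Let $\psi$ be a character of antisymmetric order $m\in\mathbb N\cup\{\infty\}$. Then the modified differential equation exists and is unique, $f_1=\psi(\bullet)f$ (so $f_1=f$ if the method is consistent, i.e. $\psi(\bullet)=1$), and $f_j=0$ for every even $j$ with $1\le j\le m$. Consequently the modified equation has an expansion in even powers of $h$ up to terms of order $h^m$: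 for every $M\in\mathbb N$ with $M\le m$, every $h\in\mathbb R$ and every $y\in\mathbb R^N$, $$\sum_{k=0}^{M-1}h^kf_{k+1}(y)=\sum_{0\le 2l<M}h^{2l}f_{2l+1}(y).$$ -/

import Mathlib

open scoped ContDiff TensorProduct

noncomputable section

/-! ### Rooted trees -/

/-- Finite multisets form a quotient of a polynomial functor: a multiset of cardinality `n` is
represented by a function on `Fin n`. -/
instance multisetQPF : QPF Multiset.{0} where
  P := ⟨ℕ, Fin⟩
  abs := fun p => (List.ofFn p.2 : Multiset _)
  repr := fun s => ⟨s.toList.length, s.toList.get⟩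
  abs_repr := fun s => by
    change ((List.ofFn s.toList.get : List _) : Multiset _) = s
    rw [List.ofFn_get, Multiset.coe_toList]
  abs_map := fun g p => by
    obtain ⟨n, u⟩ := p
    change ((List.ofFn (g ∘ u) : List _) : Multiset _) = Multiset.map g (List.ofFn u : List _)
    rw [Multiset.map_coe, List.map_ofFn]

/-- (Non-empty, finite, unlabelled, non-planar) rooted trees: the initial algebra of the functor
`Multiset`, so that a rooted tree is the same thing as a finite multiset of rooted trees, the
branches at its root. -/
def RTree : Type := QPF.Fix Multiset.{0}

namespace RTree

/-- `node {τ₁, …, τₖ} = [τ₁, …, τₖ]`, the tree whose root has the branches `τ₁, …, τₖ`. -/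
def node (s : Multiset RTree) : RTree := QPF.Fix.mk s

/-- The multiset of branches at the root. -/
def branches (τ : RTree) : Multiset RTree := QPF.Fix.dest τ

theorem node_branches (τ : RTree) : node τ.branches = τ := QPF.Fix.mk_dest τ

theorem branches_node (s : Multiset RTree) : (node s).branches = s := QPF.Fix.dest_mk s

theorem node_injective : Function.Injective node := fun s t h => by
  rw [← branches_node s, h, branches_node]

/-- Structural induction on rooted trees. -/
theorem induction {p : RTree → Prop} (h : ∀ s, (∀ t ∈ s, p t) → p (node s)) (τ : RTree) :
    p τ := by
  refine QPF.Fix.ind p (fun s hs => h s ?_) τ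
  obtain ⟨u, rfl⟩ := hs
  intro t ht
  obtain ⟨v, -, rfl⟩ := Multiset.mem_map.1 ht
  exact v.2

/-- Structural recursion on rooted trees: the value at `[τ₁, …, τₖ]` is computed from the multiset
of the branches, each of them paired with its value. -/
def fold {α : Type} (g : Multiset (RTree × α) → α) (τ : RTree) : α :=
  (QPF.Fix.rec (fun s : Multiset (RTree × α) => (node (s.map Prod.fst), g s)) τ).2

theorem fold_node {α : Type} (g : Multiset (RTree × α) → α) (s : Multiset RTree) :
    fold g (node s) = g (s.map fun t => (t, fold g t)) := by
  set G : Multiset (RTree × α) → RTree × α := fun s => (node (s.map Prod.fst), g s)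
  have key : ∀ s : Multiset RTree,
      QPF.Fix.rec G (node s) = G (s.map (QPF.Fix.rec G)) := fun s => QPF.Fix.rec_eq G s
  have hfst : ∀ τ : RTree, (QPF.Fix.rec G τ).1 = τ := by
    intro τ
    induction τ using RTree.induction with
    | h s ih =>
      rw [key]
      have h1 : (s.map fun t : RTree => QPF.Fix.rec G t).map Prod.fst = s := by
        rw [Multiset.map_map]
        conv_rhs => rw [← Multiset.map_id s]
        exact Multiset.map_congr rfl ih
      exact congrArg node h1
  change (QPF.Fix.rec G (node s)).2 = _
  rw [key]
  change g _ = g _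
  congr 1
  refine Multiset.map_congr rfl fun t _ => ?_
  exact Prod.ext (hfst t) rfl

/-- The tree with one vertex. -/
def single : RTree := node 0

/-- The order `|τ|`, i.e. the number of vertices. -/
def order : RTree → ℕ := fold fun s => 1 + (s.map Prod.snd).sum

theorem order_node (s : Multiset RTree) : (node s).order = 1 + (s.map order).sum := by
  rw [order, fold_node, Multiset.map_map]; rfl

open Classical in
/-- The symmetry factor `σ(τ)`:
`σ([τ₁^{k₁}, …, τₘ^{kₘ}]) = ∏ᵢ kᵢ! σ(τᵢ)^{kᵢ}` for distinct `τ₁, …, τₘ`. -/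
def symmetryFactor : RTree → ℕ :=
  fold fun s => (s.map Prod.snd).prod *
    ∏ t ∈ (s.map Prod.fst).toFinset, ((s.map Prod.fst).count t).factorial

open Classical in
theorem symmetryFactor_node (s : Multiset RTree) :
    (node s).symmetryFactor =
      ∏ t ∈ s.toFinset, (s.count t).factorial * t.symmetryFactor ^ s.count t := by
  have h : (s.map fun t => (t, fold (fun s : Multiset (RTree × ℕ) => (s.map Prod.snd).prod *
      ∏ t ∈ (s.map Prod.fst).toFinset, ((s.map Prod.fst).count t).factorial) t)).map Prod.fst = s := by
    rw [Multiset.map_map]; exact Multiset.map_id s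
  rw [symmetryFactor, fold_node, h, Multiset.map_map, Finset.prod_mul_distrib, mul_comm,
    Finset.prod_multiset_map_count]
  rfl

theorem finite_order_le (n : ℕ) : {τ : RTree | τ.order ≤ n}.Finite := by
  induction n with
  | zero =>
    refine Set.Finite.subset Set.finite_empty fun τ hτ => ?_
    rw [Set.mem_ofPred_eq, ← node_branches τ, order_node] at hτ
    omega
  | succ n ih =>
    have hfin : {s : Multiset RTree |
        (∀ t ∈ s, t ∈ {τ : RTree | τ.order ≤ n}) ∧ Multiset.card s ≤ n}.Finite := by
      refine Set.Finite.subset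
        ((@List.finite_length_le {τ : RTree | τ.order ≤ n} ih.to_subtype n).image
          fun l => ((l.map Subtype.val : List RTree) : Multiset RTree)) ?_
      rintro s ⟨hs, hc⟩
      refine ⟨s.toList.attach.map fun t => ⟨t.1, hs t.1 (Multiset.mem_toList.1 t.2)⟩, ?_, ?_⟩
      · simpa using hc
      · simp
    refine (hfin.image node).subset fun τ hτ => ⟨τ.branches, ⟨?_, ?_⟩, node_branches τ⟩
    · intro t ht
      rw [Set.mem_ofPred_eq, ← node_branches τ, order_node] at hτ
      have := Multiset.single_le_sum (fun x _ => Nat.zero_le x) _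
        (Multiset.mem_map_of_mem order ht)
      rw [Set.mem_ofPred_eq]
      omega
    · rw [Set.mem_ofPred_eq, ← node_branches τ, order_node] at hτ
      have h1 : ∀ x ∈ τ.branches.map order, 1 ≤ x := by
        intro x hx
        obtain ⟨t, -, rfl⟩ := Multiset.mem_map.1 hx
        rw [← node_branches t, order_node]; omega
      have := Multiset.card_nsmul_le_sum h1
      simp only [Multiset.card_map, smul_eq_mul, mul_one] at this
      omega

/-- The finite set of all rooted trees with `n` vertices. -/
def ofOrder (n : ℕ) : Finset RTree :=
  (show {τ : RTree | τ.order = n}.Finite from (finite_order_le n).subset fun _ h => by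
    rw [Set.mem_ofPred_eq] at h ⊢; exact h.le).toFinset

theorem mem_ofOrder {n : ℕ} {τ : RTree} : τ ∈ ofOrder n ↔ τ.order = n := by
  simp [ofOrder]

/-- The elementary differential `F(τ)` of a vector field `f`:
`F([τ₁, …, τₖ])(y) = f⁽ᵏ⁾(y)(F(τ₁)(y), …, F(τₖ)(y))`. The branches are listed in some order, which
does not matter for smooth `f`, since the derivative is symmetric. -/
def elementaryDifferential {E : Type} [NormedAddCommGroup E] [NormedSpace ℝ E] (f : E → E) :
    RTree → E → E :=
  fold fun s y => iteratedFDeriv ℝ s.toList.length f y fun i => (s.toList.get i).2 y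

theorem iteratedFDeriv_perm {E : Type} [NormedAddCommGroup E] [NormedSpace ℝ E]
    {f : E → E} (hf : ContDiff ℝ ∞ f) {l₁ l₂ : List E} (h : l₁.Perm l₂) (y : E) :
    iteratedFDeriv ℝ l₁.length f y l₁.get = iteratedFDeriv ℝ l₂.length f y l₂.get := by
  have hd : ∀ l : List E, ContDiff ℝ ∞ fun z => iteratedFDeriv ℝ l.length f z l.get := by
    intro l
    have h1 : ContDiff ℝ ∞ fun z => iteratedFDeriv ℝ l.length f z :=
      hf.iteratedFDeriv_right (by exact_mod_cast le_top)
    exact (ContinuousMultilinearMap.apply ℝ (fun _ : Fin l.length => E) E l.get).contDiff.comp h1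
  have hc : ∀ (v : E) (l : List E) (z : E), iteratedFDeriv ℝ (v :: l).length f z (v :: l).get =
      fderiv ℝ (fun w => iteratedFDeriv ℝ l.length f w l.get) z v := by
    intro v l z
    have h1 : DifferentiableAt ℝ (fun w => iteratedFDeriv ℝ l.length f w) z :=
      (hf.iteratedFDeriv_right (m := ∞) (by exact_mod_cast le_top)).differentiable (by simp) z
    have h2 : fderiv ℝ (fun w => iteratedFDeriv ℝ l.length f w l.get) z =
        (ContinuousMultilinearMap.apply ℝ (fun _ : Fin l.length => E) E l.get).comp
          (fderiv ℝ (fun w => iteratedFDeriv ℝ l.length f w) z) :=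
      ((ContinuousMultilinearMap.apply ℝ (fun _ : Fin l.length => E) E l.get).hasFDerivAt.comp z
        h1.hasFDerivAt).fderiv
    rw [h2]
    rfl
  induction h generalizing y with
  | nil => rfl
  | cons v _ ih => rw [hc, hc, funext ih]
  | swap a b l =>
    have hs : IsSymmSndFDerivAt ℝ (fun z => iteratedFDeriv ℝ l.length f z l.get) y :=
      (hd l).contDiffAt.isSymmSndFDerivAt (by
        rw [minSmoothness_of_isRCLikeNormedField]; exact WithTop.coe_le_coe.2 le_top)
    have h3 : ∀ u v : E, fderiv ℝ (fun z =>
        fderiv ℝ (fun w => iteratedFDeriv ℝ l.length f w l.get) z v) y u =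
        fderiv ℝ (fderiv ℝ fun w => iteratedFDeriv ℝ l.length f w l.get) y u v := by
      intro u v
      have h4 : DifferentiableAt ℝ (fderiv ℝ fun w => iteratedFDeriv ℝ l.length f w l.get) y :=
        ((hd l).fderiv_right (m := ∞) (by simp)).differentiable (by simp) y
      have h5 : fderiv ℝ (fun z =>
          fderiv ℝ (fun w => iteratedFDeriv ℝ l.length f w l.get) z v) y = _ :=
        ((ContinuousLinearMap.apply ℝ E v).hasFDerivAt.comp y h4.hasFDerivAt).fderiv
      rw [h5]
      rfl
    rw [hc, hc, funext (hc a l), funext (hc b l), h3, h3]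
    exact hs b a
  | trans _ _ ih₁ ih₂ => rw [ih₁, ih₂]

theorem elementaryDifferential_node {E : Type} [NormedAddCommGroup E] [NormedSpace ℝ E]
    {f : E → E} (hf : ContDiff ℝ ∞ f) (l : List RTree) (y : E) :
    elementaryDifferential f (node (l : Multiset RTree)) y =
      iteratedFDeriv ℝ l.length f y fun i => elementaryDifferential f (l.get i) y := by
  have key : ∀ (α : Type) (l : List α) (g : α → E),
      (iteratedFDeriv ℝ l.length f y fun i => g (l.get i)) =
        iteratedFDeriv ℝ (l.map g).length f y (l.map g).get := by
    intro α l g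
    have : ∀ (n : ℕ) (hn : n = l.length) (v : Fin n → E) (_ : ∀ i, v i = g (l.get (i.cast hn))),
        (iteratedFDeriv ℝ l.length f y fun i => g (l.get i)) = iteratedFDeriv ℝ n f y v := by
      rintro _ rfl v hv
      rw [funext hv]
      rfl
    exact this _ (by simp) _ (by simp)
  rw [show elementaryDifferential f (node (l : Multiset RTree)) = _ from fold_node _ _]
  change (iteratedFDeriv ℝ _ f y fun i => (fun p : RTree × (E → E) => p.2 y) (List.get _ i)) = _
  rw [key _ _ fun p : RTree × (E → E) => p.2 y, key _ l fun t => elementaryDifferential f t y]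
  refine iteratedFDeriv_perm hf ?_ y
  rw [← Multiset.coe_eq_coe, ← Multiset.map_coe, ← Multiset.map_coe, Multiset.coe_toList,
    Multiset.map_map]
  rfl

/-! ### Cuts -/

/-- The non-total admissible cuts `c` of a tree `τ` (the empty cut included), each recorded as the
pair `(P_c(τ), R_c(τ))` of the pruned forest and of the remaining tree at the root. A non-total
admissible cut of `[τ₁, …, τₖ]` amounts to a choice, for every `i`, either to cut the edge from the
root to `τᵢ`, and no edge in `τᵢ`, or to keep that edge and to choose a non-total admissible cut
of `τᵢ`. -/
def admissibleCuts : RTree → Multiset (Multiset RTree × RTree) :=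
  fold fun s =>
    (Multiset.Sections (s.map fun t =>
      (({t.1}, 0) : Multiset RTree × Multiset RTree) ::ₘ
        t.2.map fun c => (c.1, {c.2}))).map
      fun l => (l.sum.1, node l.sum.2)

theorem admissibleCuts_node (s : Multiset RTree) :
    (node s).admissibleCuts =
      (Multiset.Sections (s.map fun t =>
        (({t}, 0) : Multiset RTree × Multiset RTree) ::ₘ
          t.admissibleCuts.map fun c => (c.1, {c.2}))).map
        fun l => (l.sum.1, node l.sum.2) := by
  rw [admissibleCuts, fold_node, Multiset.map_map]; rfl

theorem order_pos (τ : RTree) : 0 < τ.order := by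
  rw [← node_branches τ, order_node]; omega

theorem order_of_mem_admissibleCuts (τ : RTree) :
    ∀ c ∈ τ.admissibleCuts, (c.1.map order).sum + c.2.order = τ.order := by
  have aux : ∀ s : Multiset RTree,
      (∀ t ∈ s, ∀ c ∈ t.admissibleCuts, (c.1.map order).sum + c.2.order = t.order) →
      ∀ l ∈ Multiset.Sections (s.map fun t =>
        (({t}, 0) : Multiset RTree × Multiset RTree) ::ₘ
          t.admissibleCuts.map fun c => (c.1, {c.2})),
        (l.sum.1.map order).sum + (l.sum.2.map order).sum = (s.map order).sum := by
    intro s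
    induction s using Multiset.induction with
    | empty =>
      intro _ l hl
      rw [Multiset.map_zero, Multiset.sections_zero, Multiset.mem_singleton] at hl
      simp [hl]
    | cons t s ih =>
      intro h l hl
      rw [Multiset.map_cons, Multiset.sections_cons, Multiset.mem_bind] at hl
      obtain ⟨a, ha, hl⟩ := hl
      obtain ⟨l, hl', rfl⟩ := Multiset.mem_map.1 hl
      have h1 := ih (fun t ht => h t (Multiset.mem_cons_of_mem ht)) l hl'
      have h2 : (a.1.map order).sum + (a.2.map order).sum = t.order := by
        rcases Multiset.mem_cons.1 ha with rfl | ha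
        · simp
        · obtain ⟨c, hc, rfl⟩ := Multiset.mem_map.1 ha
          simpa using h t (Multiset.mem_cons_self t s) c hc
      rw [Multiset.sum_cons, Prod.fst_add, Prod.snd_add, Multiset.map_add, Multiset.map_add,
        Multiset.sum_add, Multiset.sum_add, Multiset.map_cons, Multiset.sum_cons]
      omega
  induction τ using RTree.induction with
  | h s ih =>
    intro c hc
    rw [admissibleCuts_node] at hc
    obtain ⟨l, hl, rfl⟩ := Multiset.mem_map.1 hc
    have := aux s ih l hl
    simp only [order_node]
    omega

/-- The empty cut occurs exactly once among the non-total admissible cuts. -/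
theorem admissibleCuts_eq_cons (τ : RTree) : ∃ M : Multiset (Multiset RTree × RTree),
    τ.admissibleCuts = (0, τ) ::ₘ M ∧ ∀ c ∈ M, c.1 ≠ 0 := by
  have aux : ∀ s : Multiset RTree,
      (∀ t ∈ s, ∃ M : Multiset (Multiset RTree × RTree),
        t.admissibleCuts = (0, t) ::ₘ M ∧ ∀ c ∈ M, c.1 ≠ 0) →
      ∃ M : Multiset (Multiset (Multiset RTree × Multiset RTree)),
        Multiset.Sections (s.map fun t =>
          (({t}, 0) : Multiset RTree × Multiset RTree) ::ₘ
            t.admissibleCuts.map fun c => (c.1, {c.2})) = (s.map fun t => (0, {t})) ::ₘ M ∧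
        ∀ l ∈ M, l.sum.1 ≠ 0 := by
    intro s
    induction s using Multiset.induction with
    | empty => exact fun _ => ⟨0, by simp, by simp⟩
    | cons t s ih =>
      intro h
      obtain ⟨M, hM, hM0⟩ := ih fun t ht => h t (Multiset.mem_cons_of_mem ht)
      obtain ⟨B, hB, hB0⟩ := h t (Multiset.mem_cons_self t s)
      have h1 : (({t}, 0) : Multiset RTree × Multiset RTree) ::ₘ
          t.admissibleCuts.map (fun c => (c.1, {c.2})) =
          (0, {t}) ::ₘ ({t}, 0) ::ₘ B.map fun c => (c.1, {c.2}) := by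
        rw [hB, Multiset.map_cons, Multiset.cons_swap]
      have h2 : ∀ a ∈ (({t}, 0) : Multiset RTree × Multiset RTree) ::ₘ
          B.map fun c => (c.1, {c.2}), a.1 ≠ 0 := by
        intro a ha
        rcases Multiset.mem_cons.1 ha with rfl | ha
        · simp
        · obtain ⟨c, hc, rfl⟩ := Multiset.mem_map.1 ha
          exact hB0 c hc
      rw [Multiset.map_cons, Multiset.sections_cons, h1, Multiset.cons_bind, hM, Multiset.map_cons,
        Multiset.map_cons, Multiset.cons_add]
      refine ⟨_, rfl, fun l hl => ?_⟩
      rcases Multiset.mem_add.1 hl with hl | hl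
      · obtain ⟨l, hl', rfl⟩ := Multiset.mem_map.1 hl
        simpa using hM0 l hl'
      · obtain ⟨a, ha, hl⟩ := Multiset.mem_bind.1 hl
        obtain ⟨l, -, rfl⟩ := Multiset.mem_map.1 hl
        rw [Multiset.sum_cons, Prod.fst_add]
        exact fun h0 => h2 a ha (add_eq_zero.1 h0).1
  induction τ using RTree.induction with
  | h s ih =>
    obtain ⟨M, hM, hM0⟩ := aux s ih
    refine ⟨M.map fun l => (l.sum.1, node l.sum.2), ?_, ?_⟩
    · rw [admissibleCuts_node, hM, Multiset.map_cons]
      have h1 : ∀ s : Multiset RTree,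
          (s.map fun t => ((0, {t}) : Multiset RTree × Multiset RTree)).sum = (0, s) := by
        intro s
        induction s using Multiset.induction with
        | empty => rfl
        | cons t s ih => rw [Multiset.map_cons, Multiset.sum_cons, ih]; simp
      rw [h1]
    · intro c hc
      obtain ⟨l, hl, rfl⟩ := Multiset.mem_map.1 hc
      exact hM0 l hl

/-- All the cuts (sets of edges) `c` of a tree `τ`, each recorded as the pair formed by the forest
of those components of `τ^c` that do not contain the root of `τ`, and by the component that does.
The number `|c|` of edges cut is the number of trees in the first entry. A cut of `[τ₁, …, τₖ]`
amounts to a choice, for every `i`, of a cut of `τᵢ` and of whether to keep or to cut the edge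
from the root to `τᵢ`. -/
def allCuts : RTree → Multiset (Multiset RTree × RTree) :=
  fold fun s =>
    (Multiset.Sections (s.map fun t =>
      (t.2.map fun c => ((c.1, {c.2}) : Multiset RTree × Multiset RTree)) +
        t.2.map fun c => (c.2 ::ₘ c.1, 0))).map
      fun l => (l.sum.1, node l.sum.2)

theorem allCuts_node (s : Multiset RTree) :
    (node s).allCuts =
      (Multiset.Sections (s.map fun t =>
        (t.allCuts.map fun c => ((c.1, {c.2}) : Multiset RTree × Multiset RTree)) +
          t.allCuts.map fun c => (c.2 ::ₘ c.1, 0))).map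
        fun l => (l.sum.1, node l.sum.2) := by
  rw [allCuts, fold_node, Multiset.map_map]; rfl

end RTree

/-! ### The Butcher–Connes–Kreimer Hopf algebra -/

/-- The free commutative `ℝ`-algebra on the rooted trees; its monomials are the forests, and `1`
is the empty forest (or empty tree). -/
abbrev BCK : Type := MvPolynomial RTree ℝ

namespace BCK

open MvPolynomial

/-- The product of the trees in a forest. -/
def forest (s : Multiset RTree) : BCK := (s.map fun t => (X t : BCK)).prod

/-- The coproduct, `Δ(τ) = τ ⊗ ∅ + ∑_c P_c(τ) ⊗ R_c(τ)`, extended multiplicatively; the sum is over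
the non-total admissible cuts, and the first summand is the contribution of the total cut. -/
def comul : BCK →ₐ[ℝ] BCK ⊗[ℝ] BCK :=
  aeval fun τ => (X τ : BCK) ⊗ₜ[ℝ] (1 : BCK) +
    (τ.admissibleCuts.map fun c => forest c.1 ⊗ₜ[ℝ] (X c.2 : BCK)).sum

/-- The reduced coproduct `δ(τ) = Δ(τ) - τ ⊗ ∅ - ∅ ⊗ τ` of a tree. -/
def reducedComul (τ : RTree) : BCK ⊗[ℝ] BCK :=
  comul (X τ) - (X τ : BCK) ⊗ₜ[ℝ] (1 : BCK) - (1 : BCK) ⊗ₜ[ℝ] (X τ : BCK)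

/-- The antipode, `S(τ) = ∑_c (-1)^{|c| + 1} τ^c`, summed over all cuts of the tree `τ` and extended
multiplicatively. -/
def antipode : BCK →ₐ[ℝ] BCK :=
  aeval fun τ =>
    (τ.allCuts.map fun c => (-1 : BCK) ^ (Multiset.card c.1 + 1) * (forest c.1 * X c.2)).sum

/-- The convolution product `μ ∘ (φ ⊗ χ) ∘ Δ` of two linear maps. -/
def conv (φ χ : BCK →ₗ[ℝ] BCK) : BCK →ₗ[ℝ] BCK :=
  LinearMap.mul' ℝ BCK ∘ₗ TensorProduct.map φ χ ∘ₗ comul.toLinearMap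

/-- Iterates for the recursion that determines the convolution square root of the identity; the
`n`-th one has the correct values on the trees of order at most `n`. -/
def sqrtIdAux : ℕ → (BCK →ₐ[ℝ] BCK)
  | 0 => aeval fun _ => 0
  | n + 1 => aeval fun τ => (1 / 2 : ℝ) • ((X τ : BCK) -
      LinearMap.mul' ℝ BCK (TensorProduct.map (sqrtIdAux n).toLinearMap (sqrtIdAux n).toLinearMap
        (reducedComul τ)))

/-- `Id^{1/2}`, the unique multiplicative map whose convolution square is the identity (see
`conv_sqrtId_sqrtId`). It is given on trees by the recursion
`Id^{1/2}(τ) = (τ - μ ((Id^{1/2} ⊗ Id^{1/2}) (δ(τ)))) / 2`. -/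
def sqrtId : BCK →ₐ[ℝ] BCK := aeval fun τ => sqrtIdAux τ.order (X τ)

theorem reducedComul_eq (τ : RTree) : ∃ M : Multiset (Multiset RTree × RTree),
    reducedComul τ = (M.map fun c => forest c.1 ⊗ₜ[ℝ] (X c.2 : BCK)).sum ∧
      ∀ c ∈ M, (∀ t ∈ c.1, t.order < τ.order) ∧ c.2.order < τ.order := by
  obtain ⟨M, hM, hM0⟩ := τ.admissibleCuts_eq_cons
  refine ⟨M, ?_, fun c hc => ?_⟩
  · rw [reducedComul, comul, aeval_X, hM, Multiset.map_cons, Multiset.sum_cons]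
    simp [forest]
  · have h1 := τ.order_of_mem_admissibleCuts c (by rw [hM]; exact Multiset.mem_cons_of_mem hc)
    have h2 := c.2.order_pos
    have h3 : ∀ t ∈ c.1, t.order ≤ (c.1.map RTree.order).sum := fun t ht =>
      Multiset.single_le_sum (fun x _ => Nat.zero_le x) _ (Multiset.mem_map_of_mem RTree.order ht)
    refine ⟨fun t ht => ?_, ?_⟩
    · have := h3 t ht
      omega
    · obtain ⟨t, ht⟩ := Multiset.exists_mem_of_ne_zero (hM0 c hc)
      have := h3 t ht
      have := t.order_pos
      omega

theorem map_reducedComul_congr {φ₁ φ₂ : BCK →ₐ[ℝ] BCK} {τ : RTree}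
    (h : ∀ t : RTree, t.order < τ.order → φ₁ (X t) = φ₂ (X t)) :
    TensorProduct.map φ₁.toLinearMap φ₁.toLinearMap (reducedComul τ) =
      TensorProduct.map φ₂.toLinearMap φ₂.toLinearMap (reducedComul τ) := by
  obtain ⟨M, hM, hlt⟩ := reducedComul_eq τ
  rw [hM, map_multiset_sum, map_multiset_sum, Multiset.map_map, Multiset.map_map]
  congr 1
  refine Multiset.map_congr rfl fun c hc => ?_
  have h1 : φ₁ (forest c.1) = φ₂ (forest c.1) := by
    rw [forest, map_multiset_prod, map_multiset_prod, Multiset.map_map, Multiset.map_map]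
    congr 1
    exact Multiset.map_congr rfl fun t ht => h t ((hlt c hc).1 t ht)
  simp [h1, h c.2 (hlt c hc).2]

theorem sqrtIdAux_eq (n : ℕ) : ∀ (k : ℕ) (τ : RTree), n ≤ k → τ.order ≤ n →
    sqrtIdAux k (X τ) = sqrtIdAux n (X τ) := by
  induction n with
  | zero => intro k τ _ hτ; have := τ.order_pos; omega
  | succ n ih =>
    intro k τ hk hτ
    obtain ⟨k, rfl⟩ : ∃ j, k = j + 1 := ⟨k - 1, by omega⟩
    rw [sqrtIdAux, sqrtIdAux, aeval_X, aeval_X,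
      map_reducedComul_congr fun t ht => ih k t (by omega) (by omega)]

theorem sqrtId_X (τ : RTree) : sqrtId (X τ) = (1 / 2 : ℝ) • ((X τ : BCK) -
    LinearMap.mul' ℝ BCK (TensorProduct.map sqrtId.toLinearMap sqrtId.toLinearMap
      (reducedComul τ))) := by
  obtain ⟨n, hn⟩ : ∃ n, τ.order = n + 1 := ⟨τ.order - 1, by have := τ.order_pos; omega⟩
  have h : ∀ t : RTree, t.order < τ.order → sqrtId (X t) = sqrtIdAux n (X t) := by
    intro t ht
    rw [sqrtId, aeval_X]
    exact (sqrtIdAux_eq _ n t (by omega) le_rfl).symm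
  rw [map_reducedComul_congr h, sqrtId, aeval_X, hn, sqrtIdAux, aeval_X]

theorem conv_sqrtId_sqrtId : conv sqrtId.toLinearMap sqrtId.toLinearMap = LinearMap.id := by
  have h : ((Algebra.TensorProduct.lmul' ℝ (S := BCK)).comp
      ((Algebra.TensorProduct.map sqrtId sqrtId).comp comul)) = AlgHom.id ℝ BCK := by
    refine MvPolynomial.algHom_ext fun τ => ?_
    change LinearMap.mul' ℝ BCK (TensorProduct.map sqrtId.toLinearMap sqrtId.toLinearMap
      (comul (X τ))) = X τ
    have h1 : comul (X τ) = reducedComul τ + (X τ : BCK) ⊗ₜ[ℝ] (1 : BCK) +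
        (1 : BCK) ⊗ₜ[ℝ] (X τ : BCK) := by
      rw [reducedComul]; abel
    have h2 := sqrtId_X τ
    rw [h1]
    simp only [map_add, TensorProduct.map_tmul, LinearMap.mul'_apply, AlgHom.toLinearMap_apply,
      map_one, mul_one, one_mul]
    rw [add_assoc, ← two_smul ℝ (sqrtId (X τ)), h2, smul_smul]
    norm_num
  exact congrArg AlgHom.toLinearMap h

/-- The canonical involution, `τ ↦ (-1)^{|τ|} τ`. -/
def involution : BCK →ₐ[ℝ] BCK := aeval fun τ => (-1 : ℝ) ^ τ.order • (X τ : BCK)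

/-- The map `τ ↦ τ⁻ = (μ ∘ (S̄ ⊗ Id) ∘ Δ ∘ Id^{1/2})(τ)`, where `S̄(τ) = (-1)^{|τ|} S(τ)`. -/
def minus : BCK →ₗ[ℝ] BCK :=
  conv (antipode.comp involution).toLinearMap LinearMap.id ∘ₗ sqrtId.toLinearMap

/-- The map `τ ↦ τ⁺ = (μ ∘ (Id ⊗ (·)⁻ ∘ S) ∘ Δ)(τ)`. -/
def plus : BCK →ₗ[ℝ] BCK := conv LinearMap.id (minus ∘ₗ antipode.toLinearMap)

end BCK

/-! ### B-series methods and their antisymmetric order -/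

/-- The characters of the Hopf algebra, i.e. the elements of the Butcher group; every one of them
defines a B-series method. -/
abbrev ButcherCharacter : Type := BCK →ₐ[ℝ] ℝ

namespace ButcherCharacter

open MvPolynomial

/-- The antisymmetric order `sup {n ∈ ℕ : ψ(τ⁺) = 0 for all trees τ with |τ| ≤ n}`; it is `⊤` for a
symmetric method. -/
def antisymmetricOrder (ψ : ButcherCharacter) : ℕ∞ :=
  ⨆ (n : ℕ) (_ : ∀ τ : RTree, τ.order ≤ n → ψ (BCK.plus (X τ)) = 0), (n : ℕ∞)

variable {E : Type} [NormedAddCommGroup E] [NormedSpace ℝ E]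

/-- The coefficient of `h ^ n` in the B-series
`B_h(ψ, y) = y + ∑_τ h^{|τ|} / σ(τ) ψ(τ) F(τ)(y)` of the vector field `f`. -/
def bSeriesCoeff (ψ : ButcherCharacter) (f : E → E) (n : ℕ) (y : E) : E :=
  if n = 0 then y
  else ∑ τ ∈ RTree.ofOrder n,
    (ψ (X τ) / τ.symmetryFactor : ℝ) • τ.elementaryDifferential f y

end ButcherCharacter

/-! ### The modified differential equation -/

namespace FormalField

variable {E : Type} [NormedAddCommGroup E] [NormedSpace ℝ E]

/-- The Lie derivative `y ↦ G_h'(y) (v_h(y))` of the formal power series `G_h = ∑ h^n G_n` in `h`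
along the formal vector field `v_h = ∑ h^n c_n`. -/
def lieDeriv (c G : ℕ → E → E) : ℕ → E → E := fun n y =>
  ∑ p ∈ Finset.HasAntidiagonal.antidiagonal n, fderiv ℝ (G p.2) y (c p.1 y)

/-- The identity map, as a formal power series in `h`. -/
def idSeries : ℕ → E → E := fun n y => if n = 0 then y else 0

/-- The coefficient of `h ^ n` in the formal exact solution at time `t = h`, with initial value `y`,
of the differential equation with right-hand side `v_h = ∑ h^k c_k`. If `D` denotes the Lie
derivative along `v_h`, then a solution `u` satisfies `u⁽ⁱ⁾(t) = (Dⁱ id)(u(t))`, so that its Taylor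
series is `∑ tⁱ / i! (Dⁱ id)(y)`, in which `t = h` is substituted. -/
def flowCoeff (c : ℕ → E → E) (n : ℕ) (y : E) : E :=
  ∑ i ∈ Finset.range (n + 1), (1 / (i.factorial : ℝ)) • ((lieDeriv c)^[i] idSeries) (n - i) y

end FormalField

/-- `u' = c₀(u) + h c₁(u) + h² c₂(u) + ⋯` is the modified differential equation of the B-series
method with character `ψ`, applied to the vector field `f`: the coefficients are smooth, and one
step of the method agrees, as a formal power series in `h` and for every initial value, with the
exact solution of this equation at time `h`. In the usual numbering `c_k = f_{k+1}`. -/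
structure IsModifiedEquation {E : Type} [NormedAddCommGroup E] [NormedSpace ℝ E]
    (ψ : ButcherCharacter) (f : E → E) (c : ℕ → E → E) : Prop where
  smooth : ∀ k, ContDiff ℝ ∞ (c k)
  flow_eq : ∀ (n : ℕ) (y : E), FormalField.flowCoeff c n y = ψ.bSeriesCoeff f n y

end

/-!
The characters form a group under convolution, the Butcher group, on which `ψ ↦ ψ⁺ = ψ(·⁺)` and
`ψ ↦ ψ⁻ = ψ(·⁻)` satisfy `ψ⁺ * ψ⁻ = ψ` and `ψ⁻ * ψ⁻ = ψ̄⁻¹ * ψ`, where `ψ̄(τ) = (-1)^{|τ|} ψ(τ)`.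
If `ψ⁺` vanishes on the trees with at most `n` vertices, then `ψ` agrees with `ψ⁻` on them, so that
`ψ * ψ = ψ̄⁻¹ * ψ` and hence `ψ̄ = ψ⁻¹` up to order `n`: the method is symmetric up to order `n`.

Every character is the exponential of exactly one function `a` on trees, extended to an
infinitesimal character. The exponential turns `ψ̄ = ψ⁻¹` into `(-1)^{|τ|} a(τ) = -a(τ)`, so `a`
vanishes on the trees of even order. Finally the B-series of `exp a` is the formal flow of the field
`∑_τ h^{|τ|-1} a(τ) / σ(τ) F(τ)`: the Lie derivative of an elementary differential along another one
grafts trees, grafting is adjoint to cutting an edge, and cutting edges computes the convolution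
powers of `a`. Hence this field is the modified equation, and its coefficients at the odd powers of
`h` involve only trees of even order.
-/

noncomputable section

/-! ### Sums over multisets -/

theorem sum_map_sections {R α : Type*} [CommSemiring R] [AddCommMonoid α] {w : α → R}
    (h0 : w 0 = 1) (hadd : ∀ a b, w (a + b) = w a * w b) (S : Multiset (Multiset α)) :
    (S.Sections.map fun l => w l.sum).sum = (S.map fun m => (m.map w).sum).prod := by
  induction S using Multiset.induction with
  | empty => simpa using h0
  | cons m S ih =>
    rw [Multiset.sections_cons, Multiset.map_bind, Multiset.sum_bind, Multiset.map_cons,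
      Multiset.prod_cons, ← ih, ← Multiset.sum_map_mul_right]
    simp only [Multiset.map_map, Function.comp_def, Multiset.sum_cons, hadd,
      Multiset.sum_map_mul_left]

namespace BCK

open MvPolynomial hiding counit

/-! ### Forests and the operator `B₊` -/

@[simp] theorem forest_zero : forest 0 = 1 := by simp [forest]

@[simp] theorem forest_cons (t : RTree) (s : Multiset RTree) :
    forest (t ::ₘ s) = X t * forest s := by simp [forest]

@[simp] theorem forest_singleton (t : RTree) : forest {t} = X t := by simp [forest]

@[simp] theorem forest_add (s t : Multiset RTree) : forest (s + t) = forest s * forest t := by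
  simp [forest]

open Classical in
theorem forest_eq_monomial (s : Multiset RTree) :
    forest s = monomial (Multiset.toFinsupp s) (1 : ℝ) := by
  induction s using Multiset.induction with
  | empty => simp
  | cons t s ih =>
    rw [forest_cons, ih, ← Multiset.singleton_add, Multiset.toFinsupp_add,
      Multiset.toFinsupp_singleton, X, monomial_mul, one_mul]

open Classical in
theorem linearMap_ext_forest {M : Type*} [AddCommMonoid M] [Module ℝ M] {φ χ : BCK →ₗ[ℝ] M}
    (h : ∀ s, φ (forest s) = χ (forest s)) : φ = χ := by
  refine (basisMonomials RTree ℝ).ext fun m => ?_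
  simpa [forest_eq_monomial] using h (Finsupp.toMultiset m)

section AlgHom

variable {A : Type*} [CommSemiring A] [Algebra ℝ A] {φ χ : BCK →ₐ[ℝ] A}

theorem map_forest (φ : BCK →ₐ[ℝ] A) (s : Multiset RTree) :
    φ (forest s) = (s.map fun t => φ (X t)).prod := by
  rw [forest, map_multiset_prod, Multiset.map_map]; rfl

theorem map_forest_congr {s : Multiset RTree} (h : ∀ t ∈ s, φ (X t) = χ (X t)) :
    φ (forest s) = χ (forest s) := by
  rw [map_forest, map_forest, Multiset.map_congr rfl h]

theorem algHom_ext_node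
    (h : ∀ s, φ (forest s) = χ (forest s) → φ (X (RTree.node s)) = χ (X (RTree.node s))) :
    φ = χ := by
  refine algHom_ext fun τ => ?_
  induction τ using RTree.induction with
  | h s ih => exact h s (map_forest_congr ih)

end AlgHom

/-- The operator `B₊`, which joins the trees of a forest to a common root. -/
def bplus : BCK →ₗ[ℝ] BCK :=
  (basisMonomials RTree ℝ).constr ℝ fun m => X (RTree.node (Finsupp.toMultiset m))

open Classical in
@[simp] theorem bplus_forest (s : Multiset RTree) : bplus (forest s) = X (RTree.node s) := by
  have := (basisMonomials RTree ℝ).constr_basis ℝ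
    (fun m => (X (RTree.node (Finsupp.toMultiset m)) : BCK)) (Multiset.toFinsupp s)
  rw [coe_basisMonomials] at this
  rw [forest_eq_monomial, bplus, this, Multiset.toFinsupp_toMultiset]

/-! ### The coproduct -/

theorem comul_X (τ : RTree) : comul (X τ) = (X τ : BCK) ⊗ₜ[ℝ] (1 : BCK) +
    (τ.admissibleCuts.map fun c => forest c.1 ⊗ₜ[ℝ] (X c.2 : BCK)).sum := by
  rw [comul, aeval_X]

theorem comul_forest (s : Multiset RTree) :
    comul (forest s) = ((Multiset.Sections (s.map fun t =>
        (({t}, 0) : Multiset RTree × Multiset RTree) ::ₘ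
          t.admissibleCuts.map fun c => (c.1, {c.2}))).map
        fun l => forest l.sum.1 ⊗ₜ[ℝ] forest l.sum.2).sum := by
  rw [sum_map_sections (w := fun p : Multiset RTree × Multiset RTree =>
    forest p.1 ⊗ₜ[ℝ] forest p.2) (by simp [Algebra.TensorProduct.one_def]) (by simp),
    map_forest, Multiset.map_map]
  simp [comul_X]

theorem comul_comp_bplus : comul.toLinearMap ∘ₗ bplus =
    (TensorProduct.mk ℝ BCK BCK).flip 1 ∘ₗ bplus + bplus.lTensor BCK ∘ₗ comul.toLinearMap := by
  refine linearMap_ext_forest fun s => ?_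
  simp only [LinearMap.comp_apply, LinearMap.add_apply, AlgHom.toLinearMap_apply, bplus_forest,
    LinearMap.flip_apply, TensorProduct.mk_apply]
  rw [comul_X, comul_forest, RTree.admissibleCuts_node, map_multiset_sum, Multiset.map_map,
    Multiset.map_map]
  simp [Function.comp_def]

theorem comul_bplus (x : BCK) :
    comul (bplus x) = bplus x ⊗ₜ[ℝ] (1 : BCK) + bplus.lTensor BCK (comul x) :=
  LinearMap.congr_fun comul_comp_bplus x

/-- Coassociativity follows by induction on trees from the fact that `B₊` is a Hochschild
1-cocycle, which is `comul_bplus`. -/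
theorem comul_coassoc : (Algebra.TensorProduct.assoc ℝ ℝ ℝ BCK BCK BCK).toAlgHom.comp
      ((Algebra.TensorProduct.map comul (AlgHom.id ℝ BCK)).comp comul) =
    (Algebra.TensorProduct.map (AlgHom.id ℝ BCK) comul).comp comul := by
  refine algHom_ext_node (A := BCK ⊗[ℝ] (BCK ⊗[ℝ] BCK)) fun s ih => ?_
  change TensorProduct.assoc ℝ BCK BCK BCK (comul.toLinearMap.rTensor BCK (comul _)) =
    comul.toLinearMap.lTensor BCK (comul _) at ih ⊢
  have cut_right : ∀ z : BCK ⊗[ℝ] BCK, comul.toLinearMap.lTensor BCK (bplus.lTensor BCK z) =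
      TensorProduct.assoc ℝ BCK BCK BCK (bplus.lTensor BCK z ⊗ₜ[ℝ] (1 : BCK)) +
        (bplus.lTensor BCK).lTensor BCK (comul.toLinearMap.lTensor BCK z) := by
    intro z
    induction z with
    | zero => simp
    | add z w hz hw => simp only [map_add, TensorProduct.add_tmul, hz, hw]; abel
    | tmul p q => simp [comul_bplus, TensorProduct.tmul_add]
  have cut_left : ∀ z : BCK ⊗[ℝ] BCK, TensorProduct.assoc ℝ BCK BCK BCK
        (comul.toLinearMap.rTensor BCK (bplus.lTensor BCK z)) =
      (bplus.lTensor BCK).lTensor BCK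
        (TensorProduct.assoc ℝ BCK BCK BCK (comul.toLinearMap.rTensor BCK z)) := by
    intro z
    rw [← LinearMap.comp_apply (comul.toLinearMap.rTensor BCK), LinearMap.rTensor_comp_lTensor,
      ← LinearMap.lTensor_comp_rTensor, LinearMap.lTensor_tensor]
    simp
  rw [← bplus_forest, comul_bplus, map_add, map_add, map_add, cut_right, cut_left, ih,
    LinearMap.rTensor_tmul, AlgHom.toLinearMap_apply, comul_bplus, TensorProduct.add_tmul, map_add,
    LinearMap.lTensor_tmul, TensorProduct.assoc_tmul, AlgHom.toLinearMap_apply, map_one,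
    Algebra.TensorProduct.one_def, add_assoc]

/-! ### Counit and antipode -/

/-- The counit `ε`, which sends the empty forest to `1` and all the others to `0`. -/
def counit : BCK →ₐ[ℝ] ℝ := aeval fun _ => 0

@[simp] theorem counit_X (τ : RTree) : counit (X τ) = 0 := by simp [counit]

theorem counit_forest_of_ne_zero {s : Multiset RTree} (hs : s ≠ 0) : counit (forest s) = 0 := by
  obtain ⟨t, ht⟩ := Multiset.exists_mem_of_ne_zero hs
  obtain ⟨s, rfl⟩ := Multiset.exists_cons_of_mem ht
  rw [forest_cons, map_mul, counit_X, zero_mul]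

theorem productMap_counit_id_comp_comul :
    (Algebra.TensorProduct.productMap ((Algebra.ofId ℝ BCK).comp counit) (AlgHom.id ℝ BCK)).comp
      comul = AlgHom.id ℝ BCK := by
  refine algHom_ext fun τ => ?_
  obtain ⟨M, hM, hM0⟩ := τ.admissibleCuts_eq_cons
  have nonempty_cuts : (M.map fun c => C (counit (forest c.1)) * X c.2).sum = 0 :=
    Multiset.sum_eq_zero fun x hx => by
      obtain ⟨c, hc, rfl⟩ := Multiset.mem_map.1 hx
      rw [counit_forest_of_ne_zero (hM0 c hc), map_zero, zero_mul]
  simp [comul_X, hM, map_multiset_sum, Function.comp_def, nonempty_cuts]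

/-- The signed sum of all the cuts of a tree, with the component of the root kept apart. -/
def signedCuts (τ : RTree) : BCK ⊗[ℝ] BCK :=
  (τ.allCuts.map fun c => ((-1) ^ Multiset.card c.1 * forest c.1) ⊗ₜ[ℝ] (X c.2 : BCK)).sum

theorem antipode_X (τ : RTree) :
    antipode (X τ) = -LinearMap.mul' ℝ BCK (signedCuts τ) := by
  rw [antipode, aeval_X, signedCuts, map_multiset_sum, ← Multiset.sum_map_neg, Multiset.map_map]
  simp [pow_succ, mul_assoc]

theorem signedCuts_node (s : Multiset RTree) : signedCuts (RTree.node s) = bplus.lTensor BCK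
    (s.map fun t => antipode (X t) ⊗ₜ[ℝ] (1 : BCK) + signedCuts t).prod := by
  set w : Multiset RTree × Multiset RTree → BCK ⊗[ℝ] BCK := fun p =>
    ((-1) ^ Multiset.card p.1 * forest p.1) ⊗ₜ[ℝ] forest p.2 with hw
  have w_zero : w 0 = 1 := by simp [hw, Algebra.TensorProduct.one_def]
  have w_add : ∀ p q, w (p + q) = w p * w q := fun p q => by
    simp only [hw, Prod.fst_add, Prod.snd_add, Multiset.card_add, forest_add, pow_add,
      Algebra.TensorProduct.tmul_mul_tmul]
    congr 1
    ring
  set choices : RTree → Multiset (Multiset RTree × Multiset RTree) := fun t =>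
    (t.allCuts.map fun c => (c.1, {c.2})) + t.allCuts.map fun c => (c.2 ::ₘ c.1, 0) with hchoices
  have sum_choices : ∀ t : RTree, antipode (X t) ⊗ₜ[ℝ] (1 : BCK) + signedCuts t =
      ((choices t).map w).sum := fun t => by
    have cut_root : antipode (X t) ⊗ₜ[ℝ] (1 : BCK) =
        (t.allCuts.map fun c => w (c.2 ::ₘ c.1, 0)).sum := by
      rw [← Algebra.TensorProduct.includeLeft_apply (S := ℝ), antipode, aeval_X, map_multiset_sum,
        Multiset.map_map]
      simp [hw, mul_comm (X _ : BCK), Function.comp_def]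
    rw [cut_root, hchoices, Multiset.map_add, Multiset.sum_add, Multiset.map_map, Multiset.map_map,
      add_comm]
    simp [hw, signedCuts]
  have sum_sections := sum_map_sections w_zero w_add (s.map choices)
  simp only [Multiset.map_map, Function.comp_def, ← sum_choices] at sum_sections
  rw [← sum_sections, signedCuts, RTree.allCuts_node, map_multiset_sum, Multiset.map_map,
    Multiset.map_map]
  simp [hw, hchoices]

theorem map_antipode_id_comul_X (τ : RTree) :
    Algebra.TensorProduct.map antipode (AlgHom.id ℝ BCK) (comul (X τ)) =
      antipode (X τ) ⊗ₜ[ℝ] (1 : BCK) + signedCuts τ := by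
  set φ := Algebra.TensorProduct.map antipode (AlgHom.id ℝ BCK)
  induction τ using RTree.induction with
  | h s ih =>
    have φ_lTensor : ∀ z, φ (bplus.lTensor BCK z) = bplus.lTensor BCK (φ z) :=
      LinearMap.congr_fun (TensorProduct.ext' fun p q => rfl : φ.toLinearMap ∘ₗ bplus.lTensor BCK =
        bplus.lTensor BCK ∘ₗ φ.toLinearMap)
    rw [signedCuts_node, ← Multiset.map_congr rfl ih, ← bplus_forest, comul_bplus, map_add,
      φ_lTensor, ← AlgHom.comp_apply, map_forest]
    rfl

theorem productMap_antipode_id_comp_comul :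
    (Algebra.TensorProduct.productMap antipode (AlgHom.id ℝ BCK)).comp comul =
      (Algebra.ofId ℝ BCK).comp counit := by
  refine algHom_ext fun τ => ?_
  have mul_signedCuts : Algebra.TensorProduct.productMap antipode (AlgHom.id ℝ BCK)
      (comul (X τ)) = antipode (X τ) + LinearMap.mul' ℝ BCK (signedCuts τ) := by
    rw [Algebra.TensorProduct.productMap_eq_comp_map, AlgHom.comp_apply, map_antipode_id_comul_X,
      map_add, Algebra.TensorProduct.lmul'_apply_tmul, mul_one]
    rfl
  rw [AlgHom.comp_apply, mul_signedCuts, antipode_X]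
  simp

end BCK

/-! ### The Butcher group -/

section ProductMap

open Algebra.TensorProduct

variable {R A B C A' B' S T : Type*} [CommSemiring R] [CommSemiring A] [Algebra R A]
  [CommSemiring B] [Algebra R B] [CommSemiring C] [Algebra R C] [CommSemiring A'] [Algebra R A']
  [CommSemiring B'] [Algebra R B'] [CommSemiring S] [Algebra R S] [CommSemiring T] [Algebra R T]

theorem comp_productMap (θ : S →ₐ[R] T) (φ : A →ₐ[R] S) (χ : B →ₐ[R] S) :
    θ.comp (productMap φ χ) = productMap (θ.comp φ) (θ.comp χ) :=
  Algebra.TensorProduct.ext' fun a b => by simp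

theorem productMap_comp_map (φ : A →ₐ[R] S) (χ : B →ₐ[R] S) (α : A' →ₐ[R] A) (β : B' →ₐ[R] B) :
    (productMap φ χ).comp (map α β) = productMap (φ.comp α) (χ.comp β) :=
  Algebra.TensorProduct.ext' fun a b => by simp

theorem productMap_productMap (φ : A →ₐ[R] S) (χ : B →ₐ[R] S) (θ : C →ₐ[R] S) :
    productMap (productMap φ χ) θ = (productMap φ (productMap χ θ)).comp
      (Algebra.TensorProduct.assoc R R R A B C).toAlgHom := by
  ext x <;> simp [Algebra.TensorProduct.one_def]

end ProductMap

namespace ButcherCharacter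

open MvPolynomial hiding counit
open BCK
open Algebra.TensorProduct (productMap)

instance : Mul ButcherCharacter := ⟨fun φ χ => (productMap φ χ).comp comul⟩

instance : One ButcherCharacter := ⟨counit⟩

instance : Inv ButcherCharacter := ⟨fun φ => φ.comp antipode⟩

theorem mul_def (φ χ : ButcherCharacter) : φ * χ = (productMap φ χ).comp comul := rfl

theorem one_def : (1 : ButcherCharacter) = counit := rfl

theorem comp_ofId_comp_counit (φ : ButcherCharacter) :
    φ.comp ((Algebra.ofId ℝ BCK).comp counit) = 1 :=
  AlgHom.ext fun _ => φ.commutes _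

/-- The Butcher group: the characters of the Hopf algebra, under convolution. -/
instance : Group ButcherCharacter :=
  Group.ofLeftAxioms
    (fun φ χ θ => by
      rw [mul_def, mul_def φ, mul_def φ, mul_def χ, ← AlgHom.comp_id θ, ← productMap_comp_map,
        productMap_productMap, AlgHom.comp_assoc, AlgHom.comp_assoc, comul_coassoc,
        ← AlgHom.comp_assoc, productMap_comp_map, AlgHom.comp_id, AlgHom.comp_id])
    (fun φ => by
      have := congrArg φ.comp productMap_counit_id_comp_comul
      rwa [← AlgHom.comp_assoc, comp_productMap, comp_ofId_comp_counit, AlgHom.comp_id] at this)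
    (fun φ => by
      have := congrArg φ.comp productMap_antipode_id_comp_comul
      rwa [← AlgHom.comp_assoc, comp_productMap, comp_ofId_comp_counit, AlgHom.comp_id] at this)

/-- The convolution product of two linear functionals on the Hopf algebra; it extends the product
of the Butcher group. -/
def convFunctional (φ χ : BCK →ₗ[ℝ] ℝ) : BCK →ₗ[ℝ] ℝ :=
  LinearMap.mul' ℝ ℝ ∘ₗ TensorProduct.map φ χ ∘ₗ comul.toLinearMap

theorem mul_toLinearMap (φ χ : ButcherCharacter) :
    (φ * χ).toLinearMap = convFunctional φ.toLinearMap χ.toLinearMap := by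
  rw [mul_def, Algebra.TensorProduct.productMap_eq_comp_map]
  rfl

theorem comp_conv (ψ : ButcherCharacter) (α β : BCK →ₗ[ℝ] BCK) : ψ.toLinearMap ∘ₗ conv α β =
    convFunctional (ψ.toLinearMap ∘ₗ α) (ψ.toLinearMap ∘ₗ β) := by
  have comp_mul' : ψ.toLinearMap ∘ₗ LinearMap.mul' ℝ BCK =
      LinearMap.mul' ℝ ℝ ∘ₗ TensorProduct.map ψ.toLinearMap ψ.toLinearMap :=
    TensorProduct.ext' fun p q => by simp
  rw [conv, ← LinearMap.comp_assoc, comp_mul', convFunctional, TensorProduct.map_comp]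
  rfl

theorem mul_X (φ χ : ButcherCharacter) (τ : RTree) : (φ * χ) (X τ) =
    φ (X τ) + (τ.admissibleCuts.map fun c => φ (forest c.1) * χ (X c.2)).sum := by
  rw [mul_def, AlgHom.comp_apply, comul_X, map_add, map_multiset_sum, Multiset.map_map]
  simp [Function.comp_def]

/-! ### Agreement up to a given order -/

/-- Agreement of two characters on the trees with at most `n` vertices. It is a congruence on the
Butcher group, because the trees in an admissible cut of `τ` have at most `|τ|` vertices. -/
def agreeUpTo (n : ℕ) : Con ButcherCharacter where
  r φ χ := ∀ τ : RTree, τ.order ≤ n → φ (X τ) = χ (X τ)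
  iseqv := ⟨fun _ _ _ => rfl, fun h τ hτ => (h τ hτ).symm,
    fun h h' τ hτ => (h τ hτ).trans (h' τ hτ)⟩
  mul' {φ φ' χ χ'} hφ hχ τ hτ := by
    have forest_agree : ∀ c ∈ τ.admissibleCuts, φ (forest c.1) = φ' (forest c.1) := fun c hc => by
      refine map_forest_congr fun t ht => hφ t ?_
      have := τ.order_of_mem_admissibleCuts c hc
      have := Multiset.single_le_sum (fun x _ => Nat.zero_le x) _
        (Multiset.mem_map_of_mem RTree.order ht)
      omega
    have root_agree : ∀ c ∈ τ.admissibleCuts, χ (X c.2) = χ' (X c.2) := fun c hc => by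
      have := τ.order_of_mem_admissibleCuts c hc
      exact hχ c.2 (by omega)
    rw [mul_X, mul_X, hφ τ hτ]
    congr 2
    exact Multiset.map_congr rfl fun c hc => by rw [forest_agree c hc, root_agree c hc]

/-- The character `τ ↦ (-1)^{|τ|} φ(τ)`. For the method `φ` this amounts to replacing `h` with
`-h`. -/
def bar (φ : ButcherCharacter) : ButcherCharacter := φ.comp involution

theorem bar_X (φ : ButcherCharacter) (τ : RTree) :
    φ.bar (X τ) = (-1) ^ τ.order * φ (X τ) := by
  simp [bar, involution]

theorem bar_bar (φ : ButcherCharacter) : φ.bar.bar = φ :=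
  algHom_ext fun τ => by simp [bar_X, ← mul_assoc, ← mul_pow]

theorem agreeUpTo_bar {n : ℕ} {φ χ : ButcherCharacter} (h : agreeUpTo n φ χ) :
    agreeUpTo n φ.bar χ.bar := fun τ hτ => by
  rw [bar_X, bar_X, h τ hτ]

/-! ### Symmetry up to the antisymmetric order -/

/-- The character `ψ⁻ : τ ↦ ψ(τ⁻)`, a square root of `ψ⁻¹.bar * ψ`. -/
def minusPart (ψ : ButcherCharacter) : ButcherCharacter := (ψ⁻¹.bar * ψ).comp sqrtId

theorem comp_minus (ψ : ButcherCharacter) :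
    ψ.toLinearMap ∘ₗ minus = ψ.minusPart.toLinearMap := by
  rw [minus, ← LinearMap.comp_assoc, comp_conv, minusPart, AlgHom.comp_toLinearMap sqrtId,
    mul_toLinearMap]
  rfl

theorem comp_plus (ψ : ButcherCharacter) :
    ψ.toLinearMap ∘ₗ plus = (ψ * ψ.minusPart⁻¹).toLinearMap := by
  rw [plus, comp_conv, ← LinearMap.comp_assoc, comp_minus, mul_toLinearMap]
  rfl

theorem comp_sqrtId_mul_comp_sqrtId (φ : ButcherCharacter) :
    φ.comp sqrtId * φ.comp sqrtId = φ := by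
  refine AlgHom.toLinearMap_injective ?_
  rw [mul_toLinearMap, AlgHom.comp_toLinearMap, ← comp_conv, conv_sqrtId_sqrtId,
    LinearMap.comp_id]

theorem agreeUpTo_bar_inv_of_plus_eq_zero {ψ : ButcherCharacter} {n : ℕ}
    (h : ∀ τ : RTree, τ.order ≤ n → ψ (plus (X τ)) = 0) : agreeUpTo n ψ.bar ψ⁻¹ := by
  have mul_minusPart_inv : agreeUpTo n (ψ * ψ.minusPart⁻¹) 1 := fun τ hτ => by
    rw [one_def, counit_X, ← h τ hτ]
    exact (LinearMap.congr_fun ψ.comp_plus (X τ)).symm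
  have eq_minusPart : agreeUpTo n ψ ψ.minusPart := by
    simpa using (agreeUpTo n).mul mul_minusPart_inv ((agreeUpTo n).refl ψ.minusPart)
  have mul_self : agreeUpTo n (ψ * ψ) (ψ⁻¹.bar * ψ) := by
    simpa only [minusPart, comp_sqrtId_mul_comp_sqrtId] using
      (agreeUpTo n).mul eq_minusPart eq_minusPart
  have eq_bar_inv : agreeUpTo n ψ ψ⁻¹.bar := by
    simpa using (agreeUpTo n).mul mul_self ((agreeUpTo n).refl ψ⁻¹)
  simpa only [bar_bar] using agreeUpTo_bar eq_bar_inv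

theorem plus_eq_zero_of_le_antisymmetricOrder {ψ : ButcherCharacter} {n : ℕ}
    (h : (n : ℕ∞) ≤ ψ.antisymmetricOrder) (τ : RTree) (hτ : τ.order ≤ n) :
    ψ (plus (X τ)) = 0 := by
  have exists_order : ((τ.order - 1 : ℕ) : ℕ∞) < ψ.antisymmetricOrder := by
    refine lt_of_lt_of_le ?_ h
    have := τ.order_pos
    exact_mod_cast (by omega : τ.order - 1 < n)
  simp only [antisymmetricOrder, lt_iSup_iff, Nat.cast_lt] at exists_order
  obtain ⟨k, hk, hlt⟩ := exists_order
  exact hk τ (by omega)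

end ButcherCharacter

namespace RTree

/-! ### Edge cuts -/

open Classical in
/-- The cuts of a single edge of a tree, each recorded as the pair formed by the component without
the root and by the component with the root. -/
def edgeCuts : RTree → Multiset (RTree × RTree) :=
  fold fun s => s.bind fun p => (p.1, node ((s.map Prod.fst).erase p.1)) ::ₘ
    p.2.map fun q => (q.1, node (q.2 ::ₘ (s.map Prod.fst).erase p.1))

open Classical in
theorem edgeCuts_node (s : Multiset RTree) :
    (node s).edgeCuts = s.bind fun t => (t, node (s.erase t)) ::ₘ
      t.edgeCuts.map fun q => (q.1, node (q.2 ::ₘ s.erase t)) := by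
  have map_fst : (s.map fun t => (t, t.edgeCuts)).map Prod.fst = s := by
    rw [Multiset.map_map]; exact Multiset.map_id s
  rw [edgeCuts, fold_node]
  change ((s.map fun t => (t, t.edgeCuts)).bind fun p =>
    (p.1, node (((s.map fun t => (t, t.edgeCuts)).map Prod.fst).erase p.1)) ::ₘ
    p.2.map fun q => (q.1, node (q.2 ::ₘ
      ((s.map fun t => (t, t.edgeCuts)).map Prod.fst).erase p.1))) = _
  rw [map_fst, Multiset.bind_map]
  rfl

theorem order_of_mem_edgeCuts (τ : RTree) :
    ∀ q ∈ τ.edgeCuts, q.1.order + q.2.order = τ.order := by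
  classical
  induction τ using RTree.induction with
  | h s ih =>
    intro q hq
    rw [edgeCuts_node, Multiset.mem_bind] at hq
    obtain ⟨t, ht, hq⟩ := hq
    have order_erase : t.order + ((s.erase t).map order).sum = (s.map order).sum := by
      conv_rhs => rw [← Multiset.cons_erase ht, Multiset.map_cons, Multiset.sum_cons]
    rcases Multiset.mem_cons.1 hq with rfl | hq
    · simp only [order_node]; omega
    · obtain ⟨p, hp, rfl⟩ := Multiset.mem_map.1 hq
      have := ih t ht p hp
      simp only [order_node, Multiset.map_cons, Multiset.sum_cons]
      omega

end RTree

theorem rTensor_derivation_mul {R A : Type*} (B : Type*) [CommSemiring R] [CommSemiring A]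
    [Algebra R A] [CommSemiring B] [Algebra R B] (D : Derivation R A A) (z w : A ⊗[R] B) :
    D.toLinearMap.rTensor B (z * w) =
      z * D.toLinearMap.rTensor B w + w * D.toLinearMap.rTensor B z := by
  induction z with
  | zero => simp
  | add z z' hz hz' => simp only [map_add, add_mul, mul_add, hz, hz']; abel
  | tmul p q =>
    induction w with
    | zero => simp
    | add w w' hw hw' => simp only [map_add, add_mul, mul_add, hw, hw']; abel
    | tmul u v => simp [TensorProduct.add_tmul, mul_comm v q]

namespace BCK

open MvPolynomial hiding counit

/-! ### The derivation of an infinitesimal character -/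

open Classical in
theorem derivation_forest (D : Derivation ℝ BCK BCK) (s : Multiset RTree) :
    D (forest s) = (s.map fun t => D (X t) * forest (s.erase t)).sum := by
  induction s using Multiset.induction with
  | empty => simp
  | cons t s ih =>
    rw [forest_cons, D.leibniz, ih, Multiset.map_cons, Multiset.sum_cons, Multiset.erase_cons_head,
      smul_eq_mul, smul_eq_mul, add_comm, mul_comm (forest s), ← Multiset.sum_map_mul_left]
    congr 2
    refine Multiset.map_congr rfl fun u hu => ?_
    rw [Multiset.erase_cons_tail_of_mem hu, forest_cons]
    ring

/-- The derivation `τ ↦ a(τ) + ∑_q a(P_q(τ)) R_q(τ)`, where the sum is over the edge cuts of `τ`.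
It is the contraction of the left factor of the coproduct with the infinitesimal character that
has the values `a(τ)` on the trees. -/
def edgeDerivation (a : RTree → ℝ) : Derivation ℝ BCK BCK :=
  mkDerivation ℝ fun τ => C (a τ) + (τ.edgeCuts.map fun q => a q.1 • (X q.2 : BCK)).sum

theorem edgeDerivation_X (a : RTree → ℝ) (τ : RTree) : edgeDerivation a (X τ) =
    C (a τ) + (τ.edgeCuts.map fun q => a q.1 • (X q.2 : BCK)).sum := by
  rw [edgeDerivation, mkDerivation_X]

theorem edgeDerivation_smul (r : ℝ) (a : RTree → ℝ) :
    edgeDerivation (r • a) = r • edgeDerivation a := by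
  refine derivation_ext fun τ => ?_
  rw [Derivation.smul_apply, edgeDerivation_X, edgeDerivation_X, smul_add, Multiset.smul_sum,
    Multiset.map_map]
  simp [smul_eq_C_mul, mul_assoc]

theorem edgeDerivation_node (a : RTree → ℝ) (s : Multiset RTree) :
    edgeDerivation a (X (RTree.node s)) =
      C (a (RTree.node s)) + bplus (edgeDerivation a (forest s)) := by
  classical
  rw [edgeDerivation_X, derivation_forest, RTree.edgeCuts_node, map_multiset_sum,
    Multiset.map_bind, Multiset.sum_bind, Multiset.map_map]
  congr 2
  refine Multiset.map_congr rfl fun t _ => ?_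
  rw [Function.comp_apply, edgeDerivation_X, add_mul, map_add, Multiset.map_cons,
    Multiset.sum_cons, Multiset.map_map, ← Multiset.sum_map_mul_right, map_multiset_sum,
    Multiset.map_map, ← smul_eq_C_mul, map_smul, bplus_forest]
  congr 2
  refine Multiset.map_congr rfl fun q _ => ?_
  simp [← forest_cons]

theorem comul_edgeDerivation (a : RTree → ℝ) (x : BCK) :
    comul (edgeDerivation a x) = (edgeDerivation a).toLinearMap.rTensor BCK (comul x) := by
  have mul_closed : ∀ x y : BCK,
      comul (edgeDerivation a x) = (edgeDerivation a).toLinearMap.rTensor BCK (comul x) →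
      comul (edgeDerivation a y) = (edgeDerivation a).toLinearMap.rTensor BCK (comul y) →
      comul (edgeDerivation a (x * y)) =
        (edgeDerivation a).toLinearMap.rTensor BCK (comul (x * y)) := fun x y hx hy => by
    rw [Derivation.leibniz, map_mul, rTensor_derivation_mul, ← hx, ← hy]
    simp only [smul_eq_mul, map_add, map_mul]
  have on_trees : ∀ τ : RTree, comul (edgeDerivation a (X τ)) =
      (edgeDerivation a).toLinearMap.rTensor BCK (comul (X τ)) := fun τ => by
    induction τ using RTree.induction with
    | h s ih =>
      have on_forest : comul (edgeDerivation a (forest s)) =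
          (edgeDerivation a).toLinearMap.rTensor BCK (comul (forest s)) :=
        Multiset.prod_induction
          (fun x => comul (edgeDerivation a x) =
            (edgeDerivation a).toLinearMap.rTensor BCK (comul x))
          _ mul_closed (by simp [Algebra.TensorProduct.one_def])
          (Multiset.forall_mem_map_iff.2 ih)
      rw [edgeDerivation_node, ← bplus_forest, comul_bplus, map_add, map_add, comul_bplus,
        on_forest, LinearMap.rTensor_tmul, Derivation.coeFn_coe, bplus_forest,
        edgeDerivation_node, ← LinearMap.comp_apply (LinearMap.rTensor _ _),
        LinearMap.rTensor_comp_lTensor, ← LinearMap.lTensor_comp_rTensor, LinearMap.comp_apply,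
        TensorProduct.add_tmul, C_eq_smul_one, map_smul, map_one, Algebra.TensorProduct.one_def,
        TensorProduct.smul_tmul', add_assoc]
  induction x using MvPolynomial.induction_on with
  | C r => simp [C_eq_smul_one, Algebra.TensorProduct.one_def]
  | add x y hx hy => simp only [map_add, hx, hy]
  | mul_X x τ hx => exact mul_closed x (X τ) hx (on_trees τ)

/-- The `i`-th convolution power of the infinitesimal character that has the values `a(τ)` on the
trees. -/
def infinitesimalPow (a : RTree → ℝ) (i : ℕ) : BCK →ₗ[ℝ] ℝ :=
  counit.toLinearMap ∘ₗ ((edgeDerivation a).toLinearMap : Module.End ℝ BCK) ^ i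

theorem infinitesimalPow_zero (a : RTree → ℝ) (x : BCK) :
    infinitesimalPow a 0 x = counit x := rfl

theorem infinitesimalPow_succ (a : RTree → ℝ) (i : ℕ) (x : BCK) :
    infinitesimalPow a (i + 1) x = infinitesimalPow a i (edgeDerivation a x) := by
  simp only [infinitesimalPow, pow_succ]
  rfl

theorem infinitesimalPow_smul (r : ℝ) (a : RTree → ℝ) (i : ℕ) :
    infinitesimalPow (r • a) i = r ^ i • infinitesimalPow a i := by
  rw [infinitesimalPow, edgeDerivation_smul, Derivation.coe_smul_linearMap, smul_pow,
    LinearMap.comp_smul, infinitesimalPow]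

theorem infinitesimalPow_one_eq_zero (a : RTree → ℝ) {i : ℕ} (hi : i ≠ 0) :
    infinitesimalPow a i 1 = 0 := by
  obtain ⟨i, rfl⟩ := Nat.exists_eq_succ_of_ne_zero hi
  simp [infinitesimalPow_succ]

theorem infinitesimalPow_one_X (a : RTree → ℝ) (τ : RTree) :
    infinitesimalPow a 1 (X τ) = a τ := by
  rw [infinitesimalPow_succ, infinitesimalPow_zero, edgeDerivation_X, map_add, map_multiset_sum,
    Multiset.map_map]
  simp [counit]

theorem infinitesimalPow_succ_X (a : RTree → ℝ) {i : ℕ} (hi : i ≠ 0) (τ : RTree) :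
    infinitesimalPow a (i + 1) (X τ) =
      (τ.edgeCuts.map fun q => a q.1 * infinitesimalPow a i (X q.2)).sum := by
  rw [infinitesimalPow_succ, edgeDerivation_X, map_add, map_multiset_sum, Multiset.map_map,
    C_eq_smul_one, map_smul, infinitesimalPow_one_eq_zero a hi]
  simp

theorem infinitesimalPow_X_eq_zero (a : RTree → ℝ) {i : ℕ} {τ : RTree} (h : τ.order < i) :
    infinitesimalPow a i (X τ) = 0 := by
  induction i generalizing τ with
  | zero => omega
  | succ i ih =>
    have := τ.order_pos
    rw [infinitesimalPow_succ_X a (by omega)]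
    refine Multiset.sum_eq_zero fun x hx => ?_
    obtain ⟨q, hq, rfl⟩ := Multiset.mem_map.1 hx
    have := τ.order_of_mem_edgeCuts q hq
    have := q.1.order_pos
    rw [ih (by omega), mul_zero]

theorem infinitesimalPow_X_congr {a a' : RTree → ℝ} (i : ℕ) {τ : RTree}
    (h : ∀ t : RTree, t.order ≤ τ.order → a t = a' t) :
    infinitesimalPow a i (X τ) = infinitesimalPow a' i (X τ) := by
  induction i generalizing τ with
  | zero => rfl
  | succ i ih =>
    rcases eq_or_ne i 0 with rfl | hi
    · rw [infinitesimalPow_one_X, infinitesimalPow_one_X, h τ le_rfl]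
    · rw [infinitesimalPow_succ_X a hi, infinitesimalPow_succ_X a' hi]
      refine congrArg _ (Multiset.map_congr rfl fun q hq => ?_)
      have := τ.order_of_mem_edgeCuts q hq
      rw [h q.1 (by omega), ih fun t ht => h t (by omega)]

theorem infinitesimalPow_X_congr_of_lt {a a' : RTree → ℝ} {i : ℕ} (hi : i ≠ 1) {τ : RTree}
    (h : ∀ t : RTree, t.order < τ.order → a t = a' t) :
    infinitesimalPow a i (X τ) = infinitesimalPow a' i (X τ) := by
  rcases i with _ | i
  · rfl
  · have hi' : i ≠ 0 := by omega
    rw [infinitesimalPow_succ_X a hi', infinitesimalPow_succ_X a' hi']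
    refine congrArg _ (Multiset.map_congr rfl fun q hq => ?_)
    have := τ.order_of_mem_edgeCuts q hq
    have := q.1.order_pos
    have := q.2.order_pos
    rw [h q.1 (by omega), infinitesimalPow_X_congr i fun t ht => h t (by omega)]

theorem infinitesimalPow_mul (a : RTree → ℝ) (n : ℕ) (x y : BCK) :
    infinitesimalPow a n (x * y) = ∑ p ∈ Finset.HasAntidiagonal.antidiagonal n,
      n.choose p.1 • (infinitesimalPow a p.1 x * infinitesimalPow a p.2 y) := by
  induction n generalizing x y with
  | zero => simp [infinitesimalPow_zero]
  | succ n ih =>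
    rw [Finset.sum_antidiagonal_choose_succ_nsmul
      (fun i j => infinitesimalPow a i x * infinitesimalPow a j y), infinitesimalPow_succ,
      Derivation.leibniz, map_add, smul_eq_mul, smul_eq_mul, mul_comm y, ih, ih]
    simp only [infinitesimalPow_succ]
    congr 1
    refine Finset.sum_congr rfl fun p hp => ?_
    rw [Nat.choose_symm_of_eq_add (Finset.HasAntidiagonal.mem_antidiagonal.1 hp).symm]

end BCK

namespace ButcherCharacter

open MvPolynomial hiding counit
open BCK

theorem convFunctional_counit (χ : BCK →ₗ[ℝ] ℝ) : convFunctional counit.toLinearMap χ = χ := by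
  refine LinearMap.ext fun x => ?_
  conv_rhs => rw [← AlgHom.id_apply (R := ℝ) x, ← productMap_counit_id_comp_comul]
  simp only [convFunctional, LinearMap.comp_apply, AlgHom.comp_apply, AlgHom.toLinearMap_apply]
  induction comul x with
  | zero => simp
  | add z w hz hw => simp only [map_add, hz, hw]
  | tmul p q => simp [← smul_eq_C_mul]

theorem convFunctional_comp_edgeDerivation (a : RTree → ℝ) (φ χ : BCK →ₗ[ℝ] ℝ) :
    convFunctional (φ ∘ₗ (edgeDerivation a).toLinearMap) χ =
      convFunctional φ χ ∘ₗ (edgeDerivation a).toLinearMap := by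
  refine LinearMap.ext fun x => ?_
  simp only [convFunctional, LinearMap.comp_apply, AlgHom.toLinearMap_apply, Derivation.coeFn_coe,
    comul_edgeDerivation, LinearMap.rTensor, ← LinearMap.comp_apply (TensorProduct.map φ χ),
    ← TensorProduct.map_comp, LinearMap.comp_id]

theorem convFunctional_infinitesimalPow (a : RTree → ℝ) (i j : ℕ) :
    convFunctional (infinitesimalPow a i) (infinitesimalPow a j) =
      infinitesimalPow a (i + j) := by
  induction i with
  | zero => rw [zero_add]; exact convFunctional_counit _
  | succ i ih =>
    have pow_comp : ∀ k, infinitesimalPow a (k + 1) =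
        infinitesimalPow a k ∘ₗ (edgeDerivation a).toLinearMap := fun k =>
      LinearMap.ext fun x => infinitesimalPow_succ a k x
    rw [pow_comp, convFunctional_comp_edgeDerivation, ih, add_right_comm, pow_comp]

/-! ### The exponential -/

/-- The one-parameter group `t ↦ exp(t a)` of characters, as a polynomial in `t`. -/
def expPoly (a : RTree → ℝ) : BCK →ₐ[ℝ] Polynomial ℝ :=
  aeval fun τ => ∑ i ∈ Finset.range (τ.order + 1),
    Polynomial.monomial i (infinitesimalPow a i (X τ) / i.factorial)

theorem coeff_expPoly (a : RTree → ℝ) (i : ℕ) (x : BCK) :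
    (expPoly a x).coeff i = infinitesimalPow a i x / i.factorial := by
  induction x using MvPolynomial.induction_on generalizing i with
  | C r =>
    rw [← algebraMap_eq, AlgHom.commutes, Polynomial.algebraMap_apply, Polynomial.coeff_C,
      Algebra.algebraMap_eq_smul_one r, Algebra.algebraMap_eq_smul_one r, map_smul]
    split_ifs with h
    · simp [h, infinitesimalPow_zero]
    · simp [infinitesimalPow_one_eq_zero a h]
  | add p q hp hq => rw [map_add, Polynomial.coeff_add, hp, hq, map_add, add_div]
  | mul_X p τ hp =>
    have coeff_X : ∀ j, (expPoly a (X τ)).coeff j = infinitesimalPow a j (X τ) / j.factorial := by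
      intro j
      rw [expPoly, aeval_X, Polynomial.finsetSum_coeff]
      simp only [Polynomial.coeff_monomial, Finset.sum_ite_eq', Finset.mem_range]
      split_ifs with h
      · rfl
      · rw [infinitesimalPow_X_eq_zero a (by omega), zero_div]
    rw [map_mul, Polynomial.coeff_mul, infinitesimalPow_mul, Finset.sum_div]
    refine Finset.sum_congr rfl fun q hq => ?_
    rw [hp, coeff_X, ← Finset.HasAntidiagonal.mem_antidiagonal.1 hq, nsmul_eq_mul,
      Nat.cast_add_choose]
    have := Nat.factorial_ne_zero (q.1 + q.2)
    field_simp

theorem productMap_expPoly_comp_comul (a : RTree → ℝ) (r s : ℝ) :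
    (Algebra.TensorProduct.productMap (expPoly (r • a)) (expPoly (s • a))).comp comul =
      expPoly ((r + s) • a) := by
  have coeff_productMap : ∀ (n : ℕ) (z : BCK ⊗[ℝ] BCK),
      (Algebra.TensorProduct.productMap (expPoly (r • a)) (expPoly (s • a)) z).coeff n =
        ∑ p ∈ Finset.HasAntidiagonal.antidiagonal n,
          (r ^ p.1 * s ^ p.2 / (p.1.factorial * p.2.factorial)) * LinearMap.mul' ℝ ℝ
            (TensorProduct.map (infinitesimalPow a p.1) (infinitesimalPow a p.2) z) := by
    intro n z
    induction z with
    | zero => simp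
    | add z w hz hw =>
      simp only [map_add, Polynomial.coeff_add, hz, hw, mul_add, Finset.sum_add_distrib]
    | tmul x y =>
      simp only [Algebra.TensorProduct.productMap_apply_tmul, Polynomial.coeff_mul, coeff_expPoly,
        infinitesimalPow_smul, LinearMap.smul_apply, smul_eq_mul, TensorProduct.map_tmul,
        LinearMap.mul'_apply]
      exact Finset.sum_congr rfl fun p _ => by ring
  refine AlgHom.ext fun x => Polynomial.ext fun n => ?_
  rw [AlgHom.comp_apply, coeff_productMap, coeff_expPoly, infinitesimalPow_smul,
    (Commute.all r s).add_pow', LinearMap.smul_apply, smul_eq_mul, Finset.sum_mul, Finset.sum_div]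
  refine Finset.sum_congr rfl fun p hp => ?_
  rw [← Finset.HasAntidiagonal.mem_antidiagonal.1 hp, ← convFunctional_infinitesimalPow,
    nsmul_eq_mul, Nat.cast_add_choose]
  change _ * convFunctional _ _ x = _
  have := Nat.factorial_ne_zero (p.1 + p.2)
  field_simp

/-- The convolution exponential of the infinitesimal character that has the values `a(τ)` on the
trees. -/
def exp (a : RTree → ℝ) : ButcherCharacter := (Polynomial.aeval (1 : ℝ)).comp (expPoly a)

theorem exp_X (a : RTree → ℝ) (τ : RTree) : exp a (X τ) =
    ∑ i ∈ Finset.range (τ.order + 1), infinitesimalPow a i (X τ) / i.factorial := by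
  simp [exp, expPoly, Polynomial.eval_finsetSum]

theorem exp_smul_mul_exp_smul (a : RTree → ℝ) (r s : ℝ) :
    exp (r • a) * exp (s • a) = exp ((r + s) • a) := by
  rw [mul_def, exp, exp, ← comp_productMap, AlgHom.comp_assoc, productMap_expPoly_comp_comul, exp]

theorem exp_zero : exp 0 = 1 := by
  simpa using exp_smul_mul_exp_smul 0 0 0

theorem exp_neg (a : RTree → ℝ) : exp (-a) = (exp a)⁻¹ :=
  eq_inv_of_mul_eq_one_right (by simpa [exp_zero] using exp_smul_mul_exp_smul a 1 (-1))

theorem exp_X_sub_exp_X {a a' : RTree → ℝ} {τ : RTree}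
    (h : ∀ t : RTree, t.order < τ.order → a t = a' t) :
    exp a (X τ) - exp a' (X τ) = a τ - a' τ := by
  have := τ.order_pos
  rw [exp_X, exp_X, ← Finset.sum_sub_distrib, Finset.sum_eq_single 1]
  · simp [infinitesimalPow_one_X]
  · intro i _ hi
    rw [infinitesimalPow_X_congr_of_lt hi h, sub_self]
  · intro h_range
    rw [Finset.mem_range] at h_range
    omega

theorem agreeUpTo_exp_iff {n : ℕ} {a a' : RTree → ℝ} :
    agreeUpTo n (exp a) (exp a') ↔ ∀ τ : RTree, τ.order ≤ n → a τ = a' τ := by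
  refine ⟨fun h τ hτ => ?_, fun h τ hτ => sub_eq_zero.1 ?_⟩
  · induction hk : τ.order using Nat.strong_induction_on generalizing τ with
    | _ k ih =>
      subst hk
      rw [← sub_eq_zero, ← exp_X_sub_exp_X fun t ht => ih _ ht t (by omega) rfl, h τ hτ, sub_self]
  · rw [exp_X_sub_exp_X fun t ht => h t (by omega), h τ hτ, sub_self]

theorem exists_agreeUpTo_exp (ψ : ButcherCharacter) (n : ℕ) :
    ∃ a : RTree → ℝ, agreeUpTo n (exp a) ψ := by
  induction n with
  | zero => exact ⟨0, fun τ hτ => by have := τ.order_pos; omega⟩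
  | succ n ih =>
    obtain ⟨a, ha⟩ := ih
    set a' : RTree → ℝ := fun τ => a τ + if τ.order = n + 1 then ψ (X τ) - exp a (X τ) else 0
      with ha'
    refine ⟨a', fun τ hτ => ?_⟩
    have correction : exp a' (X τ) - exp a (X τ) = a' τ - a τ :=
      exp_X_sub_exp_X fun t ht => by rw [ha']; simp only; rw [if_neg (by omega), add_zero]
    rw [ha'] at correction
    simp only [add_sub_cancel_left] at correction
    split_ifs at correction with h
    · linarith
    · linarith [ha τ (by omega)]

theorem exp_surjective : Function.Surjective exp := by
  intro ψ
  choose a ha using ψ.exists_agreeUpTo_exp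
  refine ⟨fun τ => a τ.order τ, algHom_ext fun τ => ?_⟩
  have agree : agreeUpTo τ.order (exp fun t => a t.order t) (exp (a τ.order)) :=
    agreeUpTo_exp_iff.2 fun t ht => agreeUpTo_exp_iff.1
      (fun u hu => (ha t.order u hu).trans (ha τ.order u (hu.trans ht)).symm) t le_rfl
  exact (agree τ le_rfl).trans (ha τ.order τ le_rfl)

theorem bar_exp (a : RTree → ℝ) : (exp a).bar = exp fun τ => (-1) ^ τ.order * a τ := by
  have pow_bar : ∀ (i : ℕ) (τ : RTree), infinitesimalPow (fun t => (-1) ^ t.order * a t) i (X τ) =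
      (-1) ^ τ.order * infinitesimalPow a i (X τ) := by
    intro i
    induction i with
    | zero => intro τ; simp [infinitesimalPow_zero]
    | succ i ih =>
      intro τ
      rcases eq_or_ne i 0 with rfl | hi
      · rw [infinitesimalPow_one_X, infinitesimalPow_one_X]
      · rw [infinitesimalPow_succ_X _ hi, infinitesimalPow_succ_X _ hi,
          ← Multiset.sum_map_mul_left]
        refine congrArg _ (Multiset.map_congr rfl fun q hq => ?_)
        rw [ih, ← τ.order_of_mem_edgeCuts q hq, pow_add]
        ring
  refine algHom_ext fun τ => ?_
  rw [bar_X, exp_X, exp_X, Finset.mul_sum]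
  exact Finset.sum_congr rfl fun i _ => by rw [pow_bar, mul_div_assoc]

theorem eq_zero_of_even_order_of_agreeUpTo_bar_inv {n : ℕ} {a : RTree → ℝ}
    (h : agreeUpTo n (exp a).bar (exp a)⁻¹) {τ : RTree} (hτ : τ.order ≤ n) (he : Even τ.order) :
    a τ = 0 := by
  rw [bar_exp, ← exp_neg, agreeUpTo_exp_iff] at h
  have := h τ hτ
  rw [he.neg_one_pow, Pi.neg_apply] at this
  linarith

end ButcherCharacter

/-! ### Grafting -/

theorem count_map_eq_sum_ite {α β : Type*} [DecidableEq α] [DecidableEq β] {F : α → β} {y : β}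
    {S : Finset α} (hS : ∀ x, F x = y → x ∈ S) (M : Multiset α) :
    (M.map F).count y = ∑ x ∈ S, if F x = y then M.count x else 0 := by
  induction M using Multiset.induction with
  | empty => simp
  | cons a M ih =>
    have count_head : (if y = F a then 1 else 0) =
        ∑ x ∈ S, if F x = y then (if x = a then 1 else 0) else 0 := by
      rw [Finset.sum_eq_single a (fun x _ hx => by simp [hx])
        (fun ha => if_neg fun h => ha (hS a h)), if_pos rfl]
      simp only [eq_comm]
    rw [Multiset.map_cons, Multiset.count_cons, ih, count_head, ← Finset.sum_add_distrib]
    refine Finset.sum_congr rfl fun x _ => ?_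
    rw [Multiset.count_cons]
    split_ifs <;> rfl

theorem cons_erase_eq_iff {α : Type*} [DecidableEq α] {a b : α} {s t : Multiset α} (ha : a ∈ s)
    (hb : b ∈ t) : a ::ₘ t.erase b = s ↔ b ::ₘ s.erase a = t := by
  rw [← Multiset.cons_erase ha, ← Multiset.cons_erase hb, Multiset.cons_inj_right,
    Multiset.erase_cons_head, Multiset.erase_cons_head, Multiset.cons_inj_right, eq_comm]

namespace RTree

open Classical in
/-- The trees obtained by joining the root of `τ₁` to a vertex of a tree, with multiplicity. -/
def graft (τ₁ : RTree) : RTree → Multiset RTree :=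
  fold fun s => node (τ₁ ::ₘ s.map Prod.fst) ::ₘ
    s.bind fun p => p.2.map fun g => node (g ::ₘ (s.map Prod.fst).erase p.1)

open Classical in
theorem graft_node (τ₁ : RTree) (s : Multiset RTree) :
    graft τ₁ (node s) = node (τ₁ ::ₘ s) ::ₘ
      s.bind fun t => (graft τ₁ t).map fun g => node (g ::ₘ s.erase t) := by
  have map_fst : (s.map fun t => (t, graft τ₁ t)).map Prod.fst = s := by
    rw [Multiset.map_map]; exact Multiset.map_id s
  rw [graft, fold_node]
  change node (τ₁ ::ₘ (s.map fun t => (t, graft τ₁ t)).map Prod.fst) ::ₘ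
    ((s.map fun t => (t, graft τ₁ t)).bind fun p =>
      p.2.map fun g => node (g ::ₘ ((s.map fun t => (t, graft τ₁ t)).map Prod.fst).erase p.1)) = _
  rw [map_fst, Multiset.bind_map]
  rfl

theorem order_of_mem_graft (τ₁ τ : RTree) :
    ∀ g ∈ graft τ₁ τ, g.order = τ₁.order + τ.order := by
  classical
  induction τ using RTree.induction with
  | h s ih =>
    intro g hg
    rw [graft_node] at hg
    rcases Multiset.mem_cons.1 hg with rfl | hg
    · simp only [order_node, Multiset.map_cons, Multiset.sum_cons]; omega
    · obtain ⟨t, ht, hg⟩ := Multiset.mem_bind.1 hg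
      obtain ⟨u, hu, rfl⟩ := Multiset.mem_map.1 hg
      have order_erase : t.order + ((s.erase t).map order).sum = (s.map order).sum := by
        conv_rhs => rw [← Multiset.cons_erase ht, Multiset.map_cons, Multiset.sum_cons]
      have := ih t ht u hu
      simp only [order_node, Multiset.map_cons, Multiset.sum_cons]
      omega

open Classical in
theorem symmetryFactor_node_cons (t : RTree) (s : Multiset RTree) :
    (node (t ::ₘ s)).symmetryFactor =
      (s.count t + 1) * t.symmetryFactor * (node s).symmetryFactor := by
  have prod_insert : ∀ s' : Multiset RTree, s' ≤ t ::ₘ s → (node s').symmetryFactor =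
      ∏ u ∈ insert t s.toFinset, (s'.count u).factorial * u.symmetryFactor ^ s'.count u := by
    intro s' hs'
    rw [symmetryFactor_node]
    refine Finset.prod_subset ?_ ?_
    · rw [← Multiset.toFinset_cons]
      exact Multiset.toFinset_subset.2 (Multiset.subset_of_le hs')
    · intro u _ hu
      rw [Multiset.mem_toFinset] at hu
      simp [Multiset.count_eq_zero_of_notMem hu]
  rw [prod_insert _ le_rfl, prod_insert _ (Multiset.le_cons_self s t),
    ← Finset.mul_prod_erase _ _ (Finset.mem_insert_self t s.toFinset),
    ← Finset.mul_prod_erase _ (fun u => (s.count u).factorial * u.symmetryFactor ^ s.count u)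
      (Finset.mem_insert_self t s.toFinset),
    Finset.prod_congr rfl fun u hu => by
      rw [Multiset.count_cons_of_ne (Finset.ne_of_mem_erase hu)],
    Multiset.count_cons_self, Nat.factorial_succ, pow_succ]
  ring

open Classical in
theorem symmetryFactor_node_of_mem {t : RTree} {s : Multiset RTree} (h : t ∈ s) :
    (node s).symmetryFactor =
      s.count t * t.symmetryFactor * (node (s.erase t)).symmetryFactor := by
  obtain ⟨s, rfl⟩ := Multiset.exists_cons_of_mem h
  rw [Multiset.erase_cons_head, Multiset.count_cons_self, symmetryFactor_node_cons]

theorem symmetryFactor_pos (τ : RTree) : 0 < τ.symmetryFactor := by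
  classical
  induction τ using RTree.induction with
  | h s ih =>
    rw [symmetryFactor_node]
    exact Finset.prod_pos fun t ht =>
      Nat.mul_pos (Nat.factorial_pos _) (pow_pos (ih t (Multiset.mem_toFinset.1 ht)) _)

open Classical in
theorem count_node_graft (τ₁ : RTree) (s₂ s : Multiset RTree) :
    (graft τ₁ (node s₂)).count (node s) = (if τ₁ ::ₘ s₂ = s then 1 else 0) +
      ∑ t ∈ s₂.toFinset, ∑ g ∈ s.toFinset,
        if g ::ₘ s₂.erase t = s then s₂.count t * (graft τ₁ t).count g else 0 := by
  have count_branch : ∀ t, ((graft τ₁ t).map fun g => node (g ::ₘ s₂.erase t)).count (node s) =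
      ∑ g ∈ s.toFinset, if g ::ₘ s₂.erase t = s then (graft τ₁ t).count g else 0 := fun t => by
    rw [count_map_eq_sum_ite (S := s.toFinset) fun g hg => by simp [← node_injective hg]]
    simp only [node_injective.eq_iff]
  rw [graft_node, Multiset.count_cons, Multiset.count_bind, Finset.sum_multiset_map_count, add_comm]
  simp only [count_branch, node_injective.eq_iff, eq_comm (a := s), smul_eq_mul, Finset.mul_sum,
    mul_ite, mul_zero]

open Classical in
theorem count_edgeCuts_node (τ₁ : RTree) (s₂ s : Multiset RTree) :
    (node s).edgeCuts.count (τ₁, node s₂) = (if τ₁ ::ₘ s₂ = s then s.count τ₁ else 0) +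
      ∑ g ∈ s.toFinset, ∑ t ∈ s₂.toFinset,
        if t ::ₘ s.erase g = s₂ then s.count g * g.edgeCuts.count (τ₁, t) else 0 := by
  have count_branch : ∀ g, (g.edgeCuts.map fun q => (q.1, node (q.2 ::ₘ s.erase g))).count
        (τ₁, node s₂) =
      ∑ t ∈ s₂.toFinset, if t ::ₘ s.erase g = s₂ then g.edgeCuts.count (τ₁, t) else 0 := fun g => by
    rw [count_map_eq_sum_ite (S := s₂.toFinset.map ⟨Prod.mk τ₁, Prod.mk_right_injective τ₁⟩)
      fun q hq => ?_]
    · simp [node_injective.eq_iff]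
    · obtain ⟨rfl, h⟩ := Prod.mk.inj hq
      simp [← node_injective h]
  have count_root : (∑ g ∈ s.toFinset,
      s.count g * if τ₁ = g ∧ s₂ = s.erase g then 1 else 0) =
        if τ₁ ::ₘ s₂ = s then s.count τ₁ else 0 := by
    simp only [ite_and, mul_ite, mul_one, mul_zero, Finset.sum_ite_eq, Multiset.mem_toFinset]
    by_cases h : τ₁ ∈ s
    · rw [if_pos h]
      congr 1
      rw [eq_iff_iff]
      conv_rhs => rw [← Multiset.cons_erase h, Multiset.cons_inj_right]
    · rw [if_neg h, if_neg fun h' : τ₁ ::ₘ s₂ = s => h (h' ▸ Multiset.mem_cons_self _ _)]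
  rw [edgeCuts_node, Multiset.count_bind, Finset.sum_multiset_map_count, ← count_root,
    ← Finset.sum_add_distrib]
  refine Finset.sum_congr rfl fun g _ => ?_
  simp only [Multiset.count_cons, count_branch, Prod.mk.injEq, node_injective.eq_iff, smul_eq_mul,
    mul_add, Finset.mul_sum, mul_ite, mul_one, mul_zero]
  rw [add_comm]

open Classical in
/-- Grafting is adjoint to cutting edges, for the inner product in which distinct trees are
orthogonal and `τ` has square norm `σ(τ)`. -/
theorem symmetryFactor_mul_count_graft (τ₁ τ₂ τ : RTree) :
    τ.symmetryFactor * (graft τ₁ τ₂).count τ =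
      τ₁.symmetryFactor * τ₂.symmetryFactor * τ.edgeCuts.count (τ₁, τ₂) := by
  induction τ₂ using RTree.induction generalizing τ with
  | h s₂ ih =>
    obtain ⟨s, rfl⟩ : ∃ s, node s = τ := ⟨_, node_branches τ⟩
    rw [count_node_graft, count_edgeCuts_node, mul_add, mul_add, Finset.sum_comm]
    simp only [Finset.mul_sum]
    congr 1
    · split_ifs with h
      · rw [← h, symmetryFactor_node_cons, Multiset.count_cons_self]
        ring
      · simp
    · refine Finset.sum_congr rfl fun g hg => Finset.sum_congr rfl fun t ht => ?_
      rw [Multiset.mem_toFinset] at hg ht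
      simp only [cons_erase_eq_iff hg ht]
      split_ifs with h
      · have erase_eq : s₂.erase t = s.erase g := by rw [← h, Multiset.erase_cons_head]
        rw [symmetryFactor_node_of_mem hg, symmetryFactor_node_of_mem ht, erase_eq]
        linear_combination s.count g * (node (s.erase g)).symmetryFactor * s₂.count t * ih t ht g
      · simp

end RTree

/-! ### Derivatives of elementary differentials -/

/-- Evaluation `(φ, v) ↦ φ v` is the restriction to the diagonal of a multilinear map, with one
argument for `φ` and one for each `v i`. -/
theorem contDiff_continuousMultilinearMap_apply {𝕜 E F G ι : Type*} [NontriviallyNormedField 𝕜]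
    [NormedAddCommGroup E] [NormedSpace 𝕜 E] [NormedAddCommGroup F] [NormedSpace 𝕜 F]
    [NormedAddCommGroup G] [NormedSpace 𝕜 G] [Fintype ι] {n : WithTop ℕ∞}
    {φ : E → ContinuousMultilinearMap 𝕜 (fun _ : ι => F) G} {v : ι → E → F}
    (hφ : ContDiff 𝕜 n φ) (hv : ∀ i, ContDiff 𝕜 n (v i)) :
    ContDiff 𝕜 n fun x => φ x fun i => v i x :=
  ((ContinuousLinearMap.id 𝕜
    (ContinuousMultilinearMap 𝕜 (fun _ : ι => F) G)).continuousMultilinearMapOption.contDiff).comp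
      (contDiff_pi.2 fun _ : Option ι => hφ.prodMk (contDiff_pi.2 hv))

namespace RTree

variable {E : Type} [NormedAddCommGroup E] [NormedSpace ℝ E] {f : E → E}

theorem exists_node_ofFn (τ : RTree) :
    ∃ (k : ℕ) (w : Fin k → RTree), τ = node (List.ofFn w : List RTree) :=
  ⟨_, τ.branches.toList.get, by rw [List.ofFn_get, Multiset.coe_toList, node_branches]⟩

theorem elementaryDifferential_node_ofFn (hf : ContDiff ℝ ∞ f) {k : ℕ} (w : Fin k → RTree)
    (y : E) : elementaryDifferential f (node (List.ofFn w : List RTree)) y =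
      iteratedFDeriv ℝ k f y fun i => elementaryDifferential f (w i) y := by
  have iteratedFDeriv_cast : ∀ (n : ℕ) (hn : n = k) (v : Fin n → E)
      (_ : ∀ i, v i = elementaryDifferential f (w (i.cast hn)) y),
      iteratedFDeriv ℝ n f y v =
        iteratedFDeriv ℝ k f y fun i => elementaryDifferential f (w i) y := by
    rintro _ rfl v hv
    rw [funext hv]
    rfl
  rw [elementaryDifferential_node hf]
  exact iteratedFDeriv_cast _ (by simp) _ fun i => by simp [Fin.cast]

theorem elementaryDifferential_single (hf : ContDiff ℝ ∞ f) :
    elementaryDifferential f single = f :=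
  funext fun y => (elementaryDifferential_node hf [] y).trans (iteratedFDeriv_zero_apply _)

theorem contDiff_elementaryDifferential (hf : ContDiff ℝ ∞ f) (τ : RTree) :
    ContDiff ℝ ∞ (elementaryDifferential f τ) := by
  induction τ using RTree.induction with
  | h s ih =>
    obtain ⟨k, w, hw⟩ := exists_node_ofFn (node s)
    obtain rfl := node_injective hw
    rw [funext (elementaryDifferential_node_ofFn hf w)]
    exact contDiff_continuousMultilinearMap_apply
      (hf.iteratedFDeriv_right (by exact_mod_cast le_top)) fun i => ih _ (by simp)

open Classical in
theorem coe_ofFn_update {α : Type*} {k : ℕ} (w : Fin k → α) (i : Fin k) (g : α) :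
    ((List.ofFn (Function.update w i g) : List α) : Multiset α) =
      g ::ₘ (List.ofFn w : Multiset α).erase (w i) := by
  have ofFn_eq_cons : ∀ w : Fin k → α, ((List.ofFn w : List α) : Multiset α) =
      w i ::ₘ (Finset.univ.erase i).val.map w := fun w => by
    rw [← Multiset.map_cons, Finset.erase_val, Multiset.cons_erase (Finset.mem_univ_val i),
      Fin.univ_val_map]
  rw [ofFn_eq_cons, ofFn_eq_cons w, Multiset.erase_cons_head, Function.update_self]
  congr 1
  refine Multiset.map_congr rfl fun j hj => Function.update_of_ne ?_ ..
  exact Finset.ne_of_mem_erase (s := Finset.univ) hj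

/-- Leibniz rule: differentiating the outer derivative of `f` grafts at the root, differentiating
an argument grafts onto a branch. -/
theorem fderiv_elementaryDifferential (hf : ContDiff ℝ ∞ f) (τ₁ τ₂ : RTree) (y : E) :
    fderiv ℝ (elementaryDifferential f τ₂) y (elementaryDifferential f τ₁ y) =
      ((graft τ₁ τ₂).map fun g => elementaryDifferential f g y).sum := by
  classical
  induction τ₂ using RTree.induction with
  | h s ih =>
    obtain ⟨k, w, hw⟩ := exists_node_ofFn (node s)
    obtain rfl := node_injective hw
    have outer : DifferentiableAt ℝ (iteratedFDeriv ℝ k f) y :=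
      (hf.iteratedFDeriv_right (m := ∞) (by exact_mod_cast le_top)).differentiable (by simp) y
    have inner (i) : HasFDerivAt (elementaryDifferential f (w i))
        (fderiv ℝ (elementaryDifferential f (w i)) y) y :=
      ((contDiff_elementaryDifferential hf (w i)).differentiable (by simp) y).hasFDerivAt
    have root_graft : τ₁ ::ₘ ((List.ofFn w : List RTree) : Multiset RTree) =
        (List.ofFn (Fin.cons τ₁ w : Fin (k + 1) → RTree) : List RTree) := by
      rw [List.ofFn_succ]; rfl
    have branch_graft (i) : fderiv ℝ (elementaryDifferential f (w i)) y
        (elementaryDifferential f τ₁ y) =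
          ((graft τ₁ (w i)).map fun g => elementaryDifferential f g y).sum := ih (w i) (by simp)
    rw [funext (elementaryDifferential_node_ofFn hf w),
      (outer.hasFDerivAt.continuousMultilinearMap_apply inner).fderiv, graft_node,
      Multiset.map_cons, Multiset.sum_cons, add_apply, root_graft,
      elementaryDifferential_node_ofFn hf, iteratedFDeriv_succ_apply_left]
    congr 1
    rw [Multiset.map_bind, Multiset.sum_bind, ← Fin.univ_val_map, Multiset.map_map, sum_apply]
    refine Finset.sum_congr rfl fun i _ => ?_
    simp only [Function.comp_apply]
    rw [ContinuousLinearMap.comp_apply, branch_graft, map_multiset_sum, Multiset.map_map,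
      Multiset.map_map]
    congr 1
    refine Multiset.map_congr rfl fun g _ => ?_
    rw [Function.comp_apply, Function.comp_apply, Fin.univ_val_map, ← coe_ofFn_update,
      elementaryDifferential_node_ofFn hf, ContinuousMultilinearMap.toContinuousLinearMap_apply]
    congr 1
    exact funext fun j =>
      (Function.apply_update (fun _ t => elementaryDifferential f t y) w i g j).symm

end RTree

/-! ### The formal flow of a B-series vector field -/

theorem sum_map_eq_sum_count_nsmul {α M : Type*} [DecidableEq α] [AddCommMonoid M]
    (s : Multiset α) (g : α → M) (S : Finset α) (h : ∀ q ∈ s, q ∉ S → g q = 0) :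
    (s.map g).sum = ∑ q ∈ S, s.count q • g q := by
  rw [Finset.sum_multiset_map_count, Finset.sum_subset Finset.subset_union_left,
    ← Finset.sum_subset (Finset.subset_union_right (s₁ := s.toFinset))]
  · intro q hq hS
    rw [Finset.mem_union, or_iff_left hS, Multiset.mem_toFinset] at hq
    rw [h q hq hS, smul_zero]
  · intro q _ hs
    rw [Multiset.mem_toFinset] at hs
    rw [Multiset.count_eq_zero_of_notMem hs, zero_smul]

namespace RTree

open Classical in
theorem count_graft_div_symmetryFactor (τ₁ τ₂ τ : RTree) :
    ((graft τ₁ τ₂).count τ : ℝ) / (τ₁.symmetryFactor * τ₂.symmetryFactor) =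
      τ.edgeCuts.count (τ₁, τ₂) / τ.symmetryFactor := by
  have symmetryFactor_ne_zero (t : RTree) : (t.symmetryFactor : ℝ) ≠ 0 := by
    exact_mod_cast t.symmetryFactor_pos.ne'
  rw [div_eq_div_iff (mul_ne_zero (symmetryFactor_ne_zero _) (symmetryFactor_ne_zero _))
    (symmetryFactor_ne_zero _)]
  have adjoint := symmetryFactor_mul_count_graft τ₁ τ₂ τ
  rw [mul_comm, mul_comm ((τ.edgeCuts.count _ : ℕ) : ℝ)]
  exact_mod_cast adjoint

open Classical in
theorem sum_antidiagonal_count_edgeCuts {g : RTree × RTree → ℝ} {i : ℕ}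
    (hg : ∀ q : RTree × RTree, q.2.order < i → g q = 0) (j : ℕ) {τ : RTree}
    (hτ : τ.order = i + 1 + j) :
    ∑ p ∈ Finset.HasAntidiagonal.antidiagonal j,
      ∑ q ∈ ofOrder (p.1 + 1) ×ˢ ofOrder (i + p.2), τ.edgeCuts.count q * g q =
    (τ.edgeCuts.map g).sum := by
  have disjoint : Set.PairwiseDisjoint
      ((Finset.HasAntidiagonal.antidiagonal j : Finset (ℕ × ℕ)) : Set (ℕ × ℕ))
      fun p => ofOrder (p.1 + 1) ×ˢ ofOrder (i + p.2) := by
    refine fun p _ p' _ hne => Finset.disjoint_left.2 fun q hq hq' => hne ?_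
    simp only [Finset.mem_product, mem_ofOrder] at hq hq'
    exact Prod.ext (by omega) (by omega)
  simp only [← Finset.sum_biUnion disjoint, ← nsmul_eq_mul]
  refine (sum_map_eq_sum_count_nsmul _ _ _ fun q hq hS => ?_).symm
  have order_eq := τ.order_of_mem_edgeCuts q hq
  have order_pos := q.1.order_pos
  refine hg q (not_le.1 fun hle => hS (Finset.mem_biUnion.2
    ⟨(q.1.order - 1, q.2.order - i), ?_, ?_⟩))
  all_goals
    simp only [Finset.HasAntidiagonal.mem_antidiagonal, Finset.mem_product, mem_ofOrder]
    omega

end RTree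

namespace FormalField

open MvPolynomial hiding counit counit_X
open BCK ButcherCharacter RTree

variable {E : Type} [NormedAddCommGroup E] [NormedSpace ℝ E] {f : E → E}

theorem lieDeriv_idSeries (c : ℕ → E → E) : lieDeriv c idSeries = c := by
  funext n y
  have idSeries_zero : (idSeries 0 : E → E) = id := by funext y; simp [idSeries]
  have idSeries_of_ne {k : ℕ} (hk : k ≠ 0) : (idSeries k : E → E) = fun _ => 0 := by
    funext y; simp [idSeries, hk]
  rw [lieDeriv, Finset.Nat.sum_antidiagonal_eq_sum_range_succ_mk, Finset.sum_range_succ,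
    Finset.sum_eq_zero fun k hk => ?_]
  · simp [idSeries_zero]
  · rw [idSeries_of_ne (Nat.sub_ne_zero_of_lt (Finset.mem_range.1 hk))]
    simp

theorem lieDeriv_iterate_congr {c c' : ℕ → E → E} (i : ℕ) {n : ℕ} (h : ∀ k ≤ n, c k = c' k) :
    ∀ k ≤ n, (lieDeriv c)^[i] idSeries k = (lieDeriv c')^[i] idSeries k := by
  induction i with
  | zero => exact fun _ _ => rfl
  | succ i ih =>
    intro k hk
    rw [Function.iterate_succ_apply', Function.iterate_succ_apply']
    funext y
    refine Finset.sum_congr rfl fun p hp => ?_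
    have := Finset.HasAntidiagonal.mem_antidiagonal.1 hp
    rw [h p.1 (by omega), ih p.2 (by omega)]

theorem flowCoeff_zero (c : ℕ → E → E) (y : E) : flowCoeff c 0 y = y := by
  simp [flowCoeff, idSeries]

theorem flowCoeff_sub_flowCoeff {c c' : ℕ → E → E} {n : ℕ} (h : ∀ k < n, c k = c' k) (y : E) :
    flowCoeff c (n + 1) y - flowCoeff c' (n + 1) y = c n y - c' n y := by
  rw [flowCoeff, flowCoeff, ← Finset.sum_sub_distrib, Finset.sum_eq_single 1]
  · simp [lieDeriv_idSeries]
  · intro i hi hne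
    rw [Finset.mem_range] at hi
    rcases i with _ | i
    · simp
    · rw [lieDeriv_iterate_congr (c := c) (c' := c') (i + 1) (n := n - 1)
        (fun k hk => h k (by omega)) _ (by omega), sub_self]
  · simp

theorem flowCoeff_injective :
    Function.Injective (flowCoeff : (ℕ → E → E) → ℕ → E → E) := by
  intro c c' h
  funext n
  induction n using Nat.strong_induction_on with
  | _ n ih =>
    funext y
    have sub_eq := flowCoeff_sub_flowCoeff ih y
    rw [h, sub_self] at sub_eq
    exact sub_eq_zero.1 sub_eq.symm

/-- The coefficient of `h ^ n` in the formal series `∑_τ h^{|τ|} b(τ) / σ(τ) F(τ)`, the B-series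
with coefficients `b` without its constant term. -/
def elementarySum (f : E → E) (b : RTree → ℝ) (n : ℕ) (y : E) : E :=
  ∑ τ ∈ ofOrder n, (b τ / τ.symmetryFactor) • elementaryDifferential f τ y

theorem contDiff_elementarySum (hf : ContDiff ℝ ∞ f) (b : RTree → ℝ) (n : ℕ) :
    ContDiff ℝ ∞ (elementarySum f b n) :=
  ContDiff.sum fun τ _ => (contDiff_elementaryDifferential hf τ).const_smul _

theorem fderiv_elementarySum (hf : ContDiff ℝ ∞ f) (b : RTree → ℝ) (n : ℕ) (y v : E) :
    fderiv ℝ (elementarySum f b n) y v = ∑ τ ∈ ofOrder n,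
      (b τ / τ.symmetryFactor) • fderiv ℝ (elementaryDifferential f τ) y v := by
  have hasFDerivAt_sum : HasFDerivAt (elementarySum f b n) (∑ τ ∈ ofOrder n,
      (b τ / τ.symmetryFactor) • fderiv ℝ (elementaryDifferential f τ) y) y :=
    HasFDerivAt.fun_sum fun τ _ =>
      ((contDiff_elementaryDifferential hf τ).differentiable (by simp) y).hasFDerivAt.const_smul _
  rw [hasFDerivAt_sum.fderiv, sum_apply]
  rfl

open Classical in
theorem fderiv_elementarySum_elementarySum (hf : ContDiff ℝ ∞ f) (a b : RTree → ℝ) (m n : ℕ)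
    (y : E) : fderiv ℝ (elementarySum f b n) y (elementarySum f a m y) =
      elementarySum f (fun τ => ∑ q ∈ ofOrder m ×ˢ ofOrder n,
        τ.edgeCuts.count q * (a q.1 * b q.2)) (m + n) y := by
  have fderiv_eq_sum {τ₁ τ₂ : RTree} (h₁ : τ₁ ∈ ofOrder m) (h₂ : τ₂ ∈ ofOrder n) :
      fderiv ℝ (elementaryDifferential f τ₂) y (elementaryDifferential f τ₁ y) =
        ∑ τ ∈ ofOrder (m + n), ((graft τ₁ τ₂).count τ : ℝ) • elementaryDifferential f τ y := by
    simp only [Nat.cast_smul_eq_nsmul]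
    rw [fderiv_elementaryDifferential hf]
    refine sum_map_eq_sum_count_nsmul _ _ _ fun g hg hne => (hne ?_).elim
    rw [mem_ofOrder] at h₁ h₂ ⊢
    rw [order_of_mem_graft _ _ g hg, h₁, h₂]
  calc fderiv ℝ (elementarySum f b n) y (elementarySum f a m y)
    _ = ∑ q ∈ ofOrder m ×ˢ ofOrder n, (b q.2 / q.2.symmetryFactor * (a q.1 / q.1.symmetryFactor)) •
          fderiv ℝ (elementaryDifferential f q.2) y (elementaryDifferential f q.1 y) := by
      rw [fderiv_elementarySum hf, Finset.sum_product_right]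
      simp only [elementarySum, map_sum, map_smul, Finset.smul_sum, smul_smul]
    _ = ∑ q ∈ ofOrder m ×ˢ ofOrder n, ∑ τ ∈ ofOrder (m + n),
          (τ.edgeCuts.count q * (a q.1 * b q.2) / τ.symmetryFactor) •
            elementaryDifferential f τ y := by
      refine Finset.sum_congr rfl fun q hq => ?_
      rw [fderiv_eq_sum (Finset.mem_product.1 hq).1 (Finset.mem_product.1 hq).2, Finset.smul_sum]
      refine Finset.sum_congr rfl fun τ _ => ?_
      rw [smul_smul]
      congr 1
      linear_combination (a q.1 * b q.2) * count_graft_div_symmetryFactor q.1 q.2 τ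
    _ = _ := by
      rw [Finset.sum_comm, elementarySum]
      simp only [Finset.sum_div, Finset.sum_smul]

theorem lieDeriv_elementarySum (hf : ContDiff ℝ ∞ f) (a : RTree → ℝ) {b : RTree → ℝ} {i : ℕ}
    (hb : ∀ τ : RTree, τ.order < i → b τ = 0) :
    lieDeriv (fun k => elementarySum f a (k + 1)) (fun j => elementarySum f b (i + j)) =
      fun j => elementarySum f (fun τ => (τ.edgeCuts.map fun q => a q.1 * b q.2).sum)
        (i + 1 + j) := by
  classical
  funext j y
  have order_eq : ∀ p ∈ Finset.HasAntidiagonal.antidiagonal j,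
      p.1 + 1 + (i + p.2) = i + 1 + j := fun p hp => by
    have := Finset.HasAntidiagonal.mem_antidiagonal.1 hp
    omega
  simp only [lieDeriv, fderiv_elementarySum_elementarySum hf]
  rw [Finset.sum_congr rfl fun p hp => by rw [order_eq p hp]]
  simp only [elementarySum]
  rw [Finset.sum_comm]
  refine Finset.sum_congr rfl fun τ hτ => ?_
  rw [← Finset.sum_smul, ← Finset.sum_div,
    sum_antidiagonal_count_edgeCuts (fun q hq => by rw [hb q.2 hq, mul_zero]) j
      (mem_ofOrder.1 hτ)]

theorem lieDeriv_iterate_elementarySum (hf : ContDiff ℝ ∞ f) (a : RTree → ℝ) (i : ℕ) :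
    (lieDeriv fun k => elementarySum f a (k + 1))^[i + 1] idSeries =
      fun j => elementarySum f (fun τ => infinitesimalPow a (i + 1) (X τ)) (i + 1 + j) := by
  induction i with
  | zero =>
    rw [zero_add, Function.iterate_one, lieDeriv_idSeries]
    simp only [infinitesimalPow_one_X, add_comm]
  | succ i ih =>
    rw [Function.iterate_succ_apply', ih,
      lieDeriv_elementarySum hf a fun τ hτ => infinitesimalPow_X_eq_zero a hτ]
    simp only [infinitesimalPow_succ_X a (Nat.succ_ne_zero i)]

theorem flowCoeff_elementarySum (hf : ContDiff ℝ ∞ f) (a : RTree → ℝ) (n : ℕ) (y : E) :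
    flowCoeff (fun k => elementarySum f a (k + 1)) n y =
      (ButcherCharacter.exp a).bSeriesCoeff f n y := by
  rcases n with _ | n
  · rw [flowCoeff_zero, bSeriesCoeff, if_pos rfl]
  have summand_eq (i : ℕ) (hi : i ∈ Finset.range (n + 1)) : (1 / ((i + 1).factorial : ℝ)) •
      (lieDeriv fun k => elementarySum f a (k + 1))^[i + 1] idSeries (n + 1 - (i + 1)) y =
        ∑ τ ∈ ofOrder (n + 1), (infinitesimalPow a (i + 1) (X τ) / (i + 1).factorial /
          τ.symmetryFactor) • elementaryDifferential f τ y := by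
    rw [lieDeriv_iterate_elementarySum hf]
    beta_reduce
    rw [Nat.add_sub_cancel' (Nat.succ_le_of_lt (Finset.mem_range.1 hi)), elementarySum,
      Finset.smul_sum]
    refine Finset.sum_congr rfl fun τ _ => ?_
    rw [smul_smul]
    congr 1
    ring
  rw [flowCoeff, bSeriesCoeff, if_neg (Nat.succ_ne_zero n), Finset.sum_range_succ',
    Function.iterate_zero, id, idSeries, if_neg (by simp), smul_zero, add_zero,
    Finset.sum_congr rfl summand_eq, Finset.sum_comm]
  refine Finset.sum_congr rfl fun τ hτ => ?_
  rw [← Finset.sum_smul, exp_X, mem_ofOrder.1 hτ, Finset.sum_range_succ' _ (n + 1),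
    infinitesimalPow_zero, counit_X, zero_div, add_zero, Finset.sum_div]

end FormalField

/-! ### The modified equation -/

theorem RTree.order_eq_one_iff {τ : RTree} : τ.order = 1 ↔ τ = single := by
  refine ⟨fun h => ?_, fun h => by simp [h, single, order_node]⟩
  rw [← node_branches τ, order_node, Nat.add_eq_left, Multiset.sum_eq_zero_iff] at h
  have no_branches : τ.branches = 0 := Multiset.eq_zero_of_forall_notMem fun t ht =>
    t.order_pos.ne' (h _ (Multiset.mem_map_of_mem order ht))
  rw [← node_branches τ, no_branches, single]

theorem ButcherCharacter.exp_single (a : RTree → ℝ) :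
    exp a (MvPolynomial.X RTree.single) = a RTree.single := by
  have order_single := RTree.order_eq_one_iff.2 rfl
  rw [exp_X, order_single, Finset.sum_range_succ, Finset.sum_range_one,
    BCK.infinitesimalPow_zero, BCK.counit_X, BCK.infinitesimalPow_one_X]
  simp

namespace FormalField

open ButcherCharacter RTree

variable {E : Type} [NormedAddCommGroup E] [NormedSpace ℝ E] {f : E → E}

theorem isModifiedEquation_exp_iff (hf : ContDiff ℝ ∞ f) (a : RTree → ℝ) {c : ℕ → E → E} :
    IsModifiedEquation (exp a) f c ↔ c = fun k => elementarySum f a (k + 1) := by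
  constructor
  · intro h
    refine flowCoeff_injective (funext fun n => funext fun y => ?_)
    rw [h.flow_eq, flowCoeff_elementarySum hf]
  · rintro rfl
    exact ⟨fun k => contDiff_elementarySum hf a _, flowCoeff_elementarySum hf a⟩

theorem elementarySum_one (hf : ContDiff ℝ ∞ f) (a : RTree → ℝ) :
    elementarySum f a 1 = a single • f := by
  have ofOrder_one : ofOrder 1 = {single} := by
    ext τ
    rw [mem_ofOrder, order_eq_one_iff, Finset.mem_singleton]
  funext y
  rw [elementarySum, ofOrder_one, Finset.sum_singleton, elementaryDifferential_single hf]
  simp [single, symmetryFactor_node]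

theorem elementarySum_eq_zero {a : RTree → ℝ} {n : ℕ} (h : ∀ τ : RTree, τ.order = n → a τ = 0) :
    elementarySum f a n = 0 :=
  funext fun y => Finset.sum_eq_zero fun τ hτ => by rw [h τ (mem_ofOrder.1 hτ), zero_div, zero_smul]

end FormalField

namespace IsModifiedEquation

open FormalField ButcherCharacter

variable {E : Type} [NormedAddCommGroup E] [NormedSpace ℝ E] {f : E → E} {ψ : ButcherCharacter}
  {c : ℕ → E → E}

theorem coeff_zero (hf : ContDiff ℝ ∞ f) (h : IsModifiedEquation ψ f c) :
    c 0 = ψ (MvPolynomial.X RTree.single) • f := by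
  obtain ⟨a, rfl⟩ := exp_surjective ψ
  rw [(isModifiedEquation_exp_iff hf a).1 h, exp_single]
  exact elementarySum_one hf a

theorem coeff_eq_zero_of_odd (hf : ContDiff ℝ ∞ f) (h : IsModifiedEquation ψ f c) {k : ℕ}
    (hk : Odd k) (hle : ((k + 1 : ℕ) : ℕ∞) ≤ ψ.antisymmetricOrder) : c k = 0 := by
  obtain ⟨a, rfl⟩ := exp_surjective ψ
  have symmetric : agreeUpTo (k + 1) (exp a).bar (exp a)⁻¹ :=
    agreeUpTo_bar_inv_of_plus_eq_zero (plus_eq_zero_of_le_antisymmetricOrder hle)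
  rw [(isModifiedEquation_exp_iff hf a).1 h]
  exact elementarySum_eq_zero fun τ hτ =>
    eq_zero_of_even_order_of_agreeUpTo_bar_inv symmetric hτ.le (hτ ▸ hk.add_one)

end IsModifiedEquation

theorem existsUnique_isModifiedEquation {E : Type} [NormedAddCommGroup E] [NormedSpace ℝ E]
    {f : E → E} (hf : ContDiff ℝ ∞ f) (ψ : ButcherCharacter) : ∃! c, IsModifiedEquation ψ f c := by
  obtain ⟨a, rfl⟩ := ButcherCharacter.exp_surjective ψ
  simp only [FormalField.isModifiedEquation_exp_iff hf a, existsUnique_eq]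

theorem sum_range_eq_sum_even {M : Type*} [AddCommMonoid M] (u : ℕ → M) (n : ℕ)
    (h : ∀ k < n, Odd k → u k = 0) :
    ∑ k ∈ Finset.range n, u k = ∑ l ∈ Finset.range ((n + 1) / 2), u (2 * l) := by
  induction n with
  | zero => rfl
  | succ n ih =>
    rw [Finset.sum_range_succ, ih fun k hk => h k (by omega)]
    rcases Nat.even_or_odd' n with ⟨l, rfl | rfl⟩
    · rw [show (2 * l + 1 + 1) / 2 = l + 1 by omega, show (2 * l + 1) / 2 = l by omega,
        Finset.sum_range_succ]
    · rw [h (2 * l + 1) (by omega) ⟨l, rfl⟩, add_zero]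
      congr 2
      omega

theorem mainTheorem11_general {E : Type} [NormedAddCommGroup E] [NormedSpace ℝ E] {f : E → E}
    (hf : ContDiff ℝ ∞ f) (ψ : ButcherCharacter) :
    (∃! c : ℕ → E → E, IsModifiedEquation ψ f c) ∧
    ∀ c : ℕ → E → E, IsModifiedEquation ψ f c →
      c 0 = ψ (MvPolynomial.X RTree.single) • f ∧
      (∀ j : ℕ, 1 ≤ j → Even j → (j : ℕ∞) ≤ ψ.antisymmetricOrder → c (j - 1) = 0) ∧
      (∀ M : ℕ, (M : ℕ∞) ≤ ψ.antisymmetricOrder → ∀ (h : ℝ) (y : E),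
        ∑ k ∈ Finset.range M, h ^ k • c k y =
          ∑ l ∈ Finset.range ((M + 1) / 2), h ^ (2 * l) • c (2 * l) y) := by
  refine ⟨existsUnique_isModifiedEquation hf ψ, fun c hc =>
    ⟨hc.coeff_zero hf, fun j hj he hle => ?_, fun M hM h y => ?_⟩⟩
  · obtain ⟨k, rfl⟩ := Nat.exists_eq_add_of_le' hj
    exact hc.coeff_eq_zero_of_odd hf (by simpa [Nat.even_add_one] using he) hle
  · refine sum_range_eq_sum_even (fun k => h ^ k • c k y) M fun k hk hodd => ?_
    have coeff_eq_zero : c k = 0 :=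
      hc.coeff_eq_zero_of_odd hf hodd (le_trans (by exact_mod_cast hk) hM)
    simp [coeff_eq_zero]

end

theorem mainTheorem11 (N : ℕ) (f : EuclideanSpace ℝ (Fin N) → EuclideanSpace ℝ (Fin N))
    (hf : ContDiff ℝ ∞ f) (ψ : ButcherCharacter) (m : ℕ∞) (hm : ψ.antisymmetricOrder = m) :
    (∃! c : ℕ → EuclideanSpace ℝ (Fin N) → EuclideanSpace ℝ (Fin N), IsModifiedEquation ψ f c) ∧
    ∀ c : ℕ → EuclideanSpace ℝ (Fin N) → EuclideanSpace ℝ (Fin N), IsModifiedEquation ψ f c →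
      c 0 = ψ (MvPolynomial.X RTree.single) • f ∧
      (∀ j : ℕ, 1 ≤ j → Even j → (j : ℕ∞) ≤ m → c (j - 1) = 0) ∧
      (∀ M : ℕ, (M : ℕ∞) ≤ m → ∀ (h : ℝ) (y : EuclideanSpace ℝ (Fin N)),
        ∑ k ∈ Finset.range M, h ^ k • c k y =
          ∑ l ∈ Finset.range ((M + 1) / 2), h ^ (2 * l) • c (2 * l) y) := by
  subst hm
  exact mainTheorem11_general hf ψ
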